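/- Let $\mathcal{M}$ be a $\mathrm{II}_1$ factor (a von Neumann algebra on a complex Hilbert space that is a factor, is finite, and has no minimal projections), and let $\tau$ be its faithful normal unital trace. For a self-adjoint $A \in \mathcal{M}$ let $m_A$ be the spectral distribution of $A$, that is, the unique Borel probability measure on $\mathbb{R}$ with $\int_{\mathbb{R}} t^n \, dm_A(t) = \tau(A^n)$ for all integers $n \geq 0$, and put $\lambda_s(A) = \inf\{t \in \mathbb{R} \mid m_A((t,\infty)) \leq s\}$ for $s \in [0,1)$. For an arbitrary $T \in \mathcal{M}$ the singular value function of $T$ is $\mu_s(T) = \lambda_s(|T|)$, $s \in [0,1)$, where $|T| = (T^*T)^{1/2}$. Let $\mathcal{U}(\mathcal{M})$ denote the unitary group of $\mathcal{M}$. Then for every $T \in \mathcal{M}$, \[ \overline{\{UTV \mid U, V \in \mathcal{U}(\mathcal{M})\}} = \{S \in \mathcal{M} \mid \mu_s(S) = \mu_s(T) \text{ for all } s \in [0,1)\}, \] where the closure on the left is taken in the operator norm. -/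

import Mathlib

noncomputable section

namespace VonNeumannAlgebra

open MeasureTheory Set

variable {H : Type*} [NormedAddCommGroup H] [InnerProductSpace ℂ H] [CompleteSpace H]

/-- A von Neumann algebra is a factor if it is nonzero and its center consists of the scalars. -/
structure IsFactor (M : VonNeumannAlgebra H) : Prop where
  nontrivial : Nontrivial M.toStarSubalgebra
  center_eq_scalars : ∀ z : M.toStarSubalgebra, (∀ x : M.toStarSubalgebra, z * x = x * z) →
    ∃ c : ℂ, z = algebraMap ℂ M.toStarSubalgebra c

/-- A von Neumann algebra is finite if its identity is not Murray--von Neumann equivalent to a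
proper subprojection, that is, if every isometry in it is unitary. -/
def IsFinite (M : VonNeumannAlgebra H) : Prop :=
  ∀ v : M.toStarSubalgebra, star v * v = 1 → v * star v = 1

/-- A von Neumann algebra is diffuse if it has no minimal projections: every nonzero projection
of the algebra has a nonzero proper subprojection in the algebra. -/
def IsDiffuse (M : VonNeumannAlgebra H) : Prop :=
  ∀ p : M.toStarSubalgebra, IsStarProjection p → p ≠ 0 →
    ∃ q : M.toStarSubalgebra, IsStarProjection q ∧ q * p = q ∧ q ≠ 0 ∧ q ≠ p

/-- A `II₁` factor is a finite factor without minimal projections. -/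
structure IsIIOneFactor (M : VonNeumannAlgebra H) : Prop where
  isFactor : M.IsFactor
  isFinite : M.IsFinite
  isDiffuse : M.IsDiffuse

open scoped ComplexOrder in
/-- The linear functional `τ` is a faithful normal unital trace on `M`. Normality says that `τ`
preserves suprema of bounded upward directed sets of positive elements. -/
structure IsFaithfulNormalTrace (M : VonNeumannAlgebra H) (τ : M.toStarSubalgebra →ₗ[ℂ] ℂ) :
    Prop where
  map_one : τ 1 = 1
  nonneg : ∀ x, 0 ≤ τ (star x * x)
  map_mul_comm : ∀ x y, τ (x * y) = τ (y * x)
  faithful : ∀ x, τ (star x * x) = 0 → x = 0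
  normal : ∀ (D : Set M.toStarSubalgebra) (a : M.toStarSubalgebra), D.Nonempty →
    DirectedOn (· ≤ ·) D → (∀ x ∈ D, 0 ≤ x) → IsLUB D a →
    IsLUB ((fun x => (τ x).re) '' D) (τ a).re

/-- An operator that commutes with the commutant of `M` belongs to `M`. -/
theorem mem_of_commute_commutant (M : VonNeumannAlgebra H) {x : H →L[ℂ] H}
    (h : ∀ y ∈ M.commutant, Commute x y) : x ∈ M.toStarSubalgebra := by
  have : x ∈ M.commutant.commutant := mem_commutant_iff.2 fun y hy => (h y hy).eq.symm
  rw [commutant_commutant] at this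
  exact this

theorem abs_mem (M : VonNeumannAlgebra H) (x : M.toStarSubalgebra) :
    CFC.abs (x : H →L[ℂ] H) ∈ M.toStarSubalgebra := by
  refine M.mem_of_commute_commutant fun y hy => Commute.cfcAbs_left ?_ ?_
  · exact mem_commutant_iff.1 hy _ x.2
  · exact mem_commutant_iff.1 (star_mem hy) _ x.2

/-- The absolute value `|x| = (x* x)^(1/2)` of an element of `M`, as an element of `M`. -/
def absVal (M : VonNeumannAlgebra H) (x : M.toStarSubalgebra) : M.toStarSubalgebra :=
  ⟨CFC.abs (x : H →L[ℂ] H), M.abs_mem x⟩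

/-- `m` is a Borel probability measure on the line whose moments are the numbers `τ (xⁿ)`. -/
structure IsSpectralDistribution (M : VonNeumannAlgebra H) (τ : M.toStarSubalgebra →ₗ[ℂ] ℂ)
    (x : M.toStarSubalgebra) (m : Measure ℝ) : Prop where
  isProbabilityMeasure : IsProbabilityMeasure m
  integrable_pow : ∀ n : ℕ, Integrable (fun t : ℝ => t ^ n) m
  integral_pow : ∀ n : ℕ, ((∫ t, t ^ n ∂m : ℝ) : ℂ) = τ (x ^ n)

theorem cfcHom_mem (M : VonNeumannAlgebra H) (x : M.toStarSubalgebra)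
    (hx : IsSelfAdjoint (x : H →L[ℂ] H)) (f : C(spectrum ℝ (x : H →L[ℂ] H), ℝ)) :
    cfcHom (R := ℝ) hx f ∈ M.toStarSubalgebra := by
  refine M.mem_of_commute_commutant fun y hy => ?_
  exact IsSelfAdjoint.commute_cfcHom (p := IsSelfAdjoint) hx hx (mem_commutant_iff.1 hy _ x.2) f

open scoped ComplexOrder in
theorem exists_isSpectralDistribution_aux (M : VonNeumannAlgebra H)
    {τ : M.toStarSubalgebra →ₗ[ℂ] ℂ} (hτ : M.IsFaithfulNormalTrace τ) {x : M.toStarSubalgebra}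
    (hx : IsSelfAdjoint x) :
    ∃ m R, M.IsSpectralDistribution τ x m ∧ 0 < R ∧ ∀ᵐ t ∂m, |t| ≤ R := by
  have hx' : IsSelfAdjoint (x : H →L[ℂ] H) := by
    have := congrArg Subtype.val hx.star_eq
    exact this
  let φ : C(spectrum ℝ (x : H →L[ℂ] H), ℝ) → M.toStarSubalgebra :=
    fun f => ⟨cfcHom (R := ℝ) hx' f, M.cfcHom_mem x hx' f⟩
  let X := spectrum ℝ (x : H →L[ℂ] H)
  have : CompactSpace X := isCompact_iff_compactSpace.1 (spectrum.isCompact _)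
  have hpos : ∀ f : C(X, ℝ), 0 ≤ f → 0 ≤ τ (φ f) := by
    intro f hf
    let g : C(X, ℝ) := ⟨fun t => Real.sqrt (f t), by fun_prop⟩
    have hg : φ f = star (φ g) * φ g := by
      apply Subtype.ext
      change cfcHom (R := ℝ) hx' f = star (cfcHom (R := ℝ) hx' g) * cfcHom (R := ℝ) hx' g
      rw [← map_star, ← map_mul]
      congr 1
      ext t
      exact (Real.mul_self_sqrt (hf t)).symm
    rw [hg]
    exact hτ.nonneg _
  let L : CompactlySupportedContinuousMap X ℝ →ₗ[ℝ] ℝ :=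
    { toFun := fun f => (τ (φ f.toContinuousMap)).re
      map_add' := fun f g => by
        have : φ (f + g).toContinuousMap = φ f.toContinuousMap + φ g.toContinuousMap :=
          Subtype.ext (map_add (cfcHom (R := ℝ) hx') f.toContinuousMap g.toContinuousMap)
        rw [this, map_add, Complex.add_re]
      map_smul' := fun c f => by
        have : φ (c • f).toContinuousMap = (c : ℂ) • φ f.toContinuousMap :=
          Subtype.ext ((map_smul (cfcHom (R := ℝ) hx') c f.toContinuousMap).trans
            (Complex.coe_smul c _).symm)
        rw [this, map_smul]
        simp }
  let Λ : CompactlySupportedContinuousMap X ℝ →ₚ[ℝ] ℝ :=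
    PositiveLinearMap.mk₀ L fun f hf => (Complex.le_def.1 (hpos f.toContinuousMap hf)).1
  let μ := RealRMK.rieszMeasure Λ
  have hm : ∀ f : C(X, ℝ), ((∫ t, f t ∂μ : ℝ) : ℂ) = τ (φ f) := by
    intro f
    let f' : CompactlySupportedContinuousMap X ℝ := ⟨f, HasCompactSupport.of_compactSpace _⟩
    have h1 : ∫ t, f t ∂μ = (τ (φ f)).re := RealRMK.integral_rieszMeasure Λ f'
    rw [h1]
    have him : (τ (φ f)).im = 0 := by
      let fp : C(X, ℝ) := f ⊔ 0
      let fm : C(X, ℝ) := (-f) ⊔ 0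
      have h2 : φ fp - φ fm = φ f := by
        apply Subtype.ext
        refine (map_sub (cfcHom (R := ℝ) hx') fp fm).symm.trans (congrArg _ ?_)
        ext t
        change max (f t) 0 - max (-f t) 0 = f t
        rcases le_total (f t) 0 with h | h
        · rw [max_eq_right h, max_eq_left (by linarith)]; ring
        · rw [max_eq_left h, max_eq_right (by linarith)]; ring
      rw [← h2, map_sub, Complex.sub_im, ← (Complex.le_def.1 (hpos fp le_sup_right)).2,
        ← (Complex.le_def.1 (hpos fm le_sup_right)).2]
      simp
    exact Complex.ext rfl him.symm
  have hmeas : Measurable (Subtype.val : X → ℝ) := measurable_subtype_coe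
  have hpow : ∀ n : ℕ, ((∫ t : X, (t : ℝ) ^ n ∂μ : ℝ) : ℂ) = τ (x ^ n) := by
    intro n
    let idX : C(X, ℝ) := ⟨Subtype.val, continuous_subtype_val⟩
    have h3 : φ (idX ^ n) = x ^ n := by
      apply Subtype.ext
      change cfcHom (R := ℝ) hx' (idX ^ n) = (x : H →L[ℂ] H) ^ n
      rw [map_pow]
      congr 1
      exact cfcHom_id hx'
    rw [← h3]
    exact hm (idX ^ n)
  have hprob : IsProbabilityMeasure μ := by
    have h4 := hpow 0
    rw [pow_zero, hτ.map_one] at h4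
    have h5 : μ.real univ = 1 := by
      have : ((μ.real univ : ℝ) : ℂ) = 1 := by simpa using h4
      exact_mod_cast this
    constructor
    rwa [measureReal_def, ENNReal.toReal_eq_one_iff] at h5
  obtain ⟨R, hR0, hR⟩ := (spectrum.isCompact (x : H →L[ℂ] H) (𝕜 := ℝ)).isBounded.exists_pos_norm_le
  have hcont : ∀ n : ℕ, Continuous fun t : ℝ => t ^ n := fun n => by fun_prop
  refine ⟨μ.map Subtype.val, R, ⟨Measure.isProbabilityMeasure_map hmeas.aemeasurable,
    fun n => ?_, fun n => ?_⟩, hR0, ?_⟩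
  · rw [integrable_map_measure (hcont n).aestronglyMeasurable hmeas.aemeasurable]
    refine Continuous.integrable_of_hasCompactSupport ?_ (HasCompactSupport.of_compactSpace _)
    exact (hcont n).comp continuous_subtype_val
  · rw [integral_map hmeas.aemeasurable (hcont n).aestronglyMeasurable]
    exact hpow n
  · rw [ae_map_iff hmeas.aemeasurable (measurableSet_le (by fun_prop) measurable_const)]
    exact Filter.Eventually.of_forall fun t => hR t t.2

/-- A measure whose even moments grow at most like `R ^ (2 n)` is carried by `[-R, R]`. -/
theorem ae_abs_le_of_integral_pow_le {m : Measure ℝ} [IsProbabilityMeasure m] {R : ℝ} (hR : 0 < R)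
    (hint : ∀ n : ℕ, Integrable (fun t : ℝ => t ^ n) m)
    (h : ∀ n : ℕ, ∫ t, t ^ (2 * n) ∂m ≤ R ^ (2 * n)) : ∀ᵐ t ∂m, |t| ≤ R := by
  have key : ∀ r : ℝ, R < r → m {t | r ≤ |t|} = 0 := by
    intro r hr
    have hr0 : 0 < r := hR.trans hr
    have hle : ∀ n : ℕ, m.real {t | r ≤ |t|} ≤ ((R / r) ^ 2) ^ n := by
      intro n
      have h1 := mul_meas_ge_le_integral_of_nonneg (μ := m) (f := fun t : ℝ => t ^ (2 * n))
        (Filter.Eventually.of_forall fun t => by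
          simp only [pow_mul, Pi.zero_apply]; positivity) (hint _) (r ^ (2 * n))
      have h2 : m.real {t | r ≤ |t|} ≤ m.real {t : ℝ | r ^ (2 * n) ≤ t ^ (2 * n)} := by
        refine measureReal_mono (fun t ht => ?_) (measure_ne_top _ _)
        have ht' : r ≤ |t| := ht
        have h3 := pow_le_pow_left₀ hr0.le ht' (2 * n)
        rwa [(even_two_mul n).pow_abs] at h3
      have h4 : r ^ (2 * n) * m.real {t | r ≤ |t|} ≤ R ^ (2 * n) :=
        (mul_le_mul_of_nonneg_left h2 (by positivity)).trans (h1.trans (h n))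
      rw [← pow_mul, div_pow, le_div_iff₀ (by positivity), mul_comm]
      exact h4
    have hlt : (R / r) ^ 2 < 1 := by
      have : R / r < 1 := (div_lt_one hr0).2 hr
      have h0 : 0 < R / r := by positivity
      nlinarith
    have hlim := tendsto_pow_atTop_nhds_zero_of_lt_one (sq_nonneg (R / r)) hlt
    have h0 : m.real {t | r ≤ |t|} ≤ 0 := ge_of_tendsto' hlim hle
    have := le_antisymm h0 measureReal_nonneg
    rwa [measureReal_eq_zero_iff] at this
  have hall : ∀ᵐ t ∂m, ∀ k : ℕ, ¬ (R + 1 / ((k : ℝ) + 1) ≤ |t|) := by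
    rw [ae_all_iff]
    intro k
    rw [ae_iff]
    simpa using key (R + 1 / ((k : ℝ) + 1)) (by linarith [Nat.one_div_pos_of_nat (α := ℝ) (n := k)])
  filter_upwards [hall] with t ht
  by_contra! hc
  obtain ⟨k, hk⟩ := exists_nat_one_div_lt (sub_pos.2 hc)
  exact ht k (by linarith)

/-- Every self-adjoint element of `M` has exactly one spectral distribution. -/
theorem existsUnique_isSpectralDistribution (M : VonNeumannAlgebra H)
    {τ : M.toStarSubalgebra →ₗ[ℂ] ℂ} (hτ : M.IsFaithfulNormalTrace τ) {x : M.toStarSubalgebra}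
    (hx : IsSelfAdjoint x) : ∃! m, M.IsSpectralDistribution τ x m := by
  obtain ⟨m, R, hm, hR, hmR⟩ := M.exists_isSpectralDistribution_aux hτ hx
  refine ⟨m, hm, fun m' hm' => ?_⟩
  have := hm.isProbabilityMeasure
  have := hm'.isProbabilityMeasure
  have hmom : ∀ n : ℕ, ∫ t, t ^ n ∂m' = ∫ t, t ^ n ∂m := fun n => by
    exact_mod_cast (hm'.integral_pow n).trans (hm.integral_pow n).symm
  have hmR' : ∀ᵐ t ∂m', |t| ≤ R := by
    refine ae_abs_le_of_integral_pow_le hR hm'.integrable_pow fun n => ?_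
    rw [hmom]
    have h1 : ∫ t, t ^ (2 * n) ∂m ≤ ∫ _, R ^ (2 * n) ∂m := by
      refine integral_mono_ae (hm.integrable_pow _) (integrable_const _) ?_
      filter_upwards [hmR] with t ht
      rw [← (even_two_mul n).pow_abs]
      exact pow_le_pow_left₀ (abs_nonneg t) ht _
    simpa using h1
  have hpint : ∀ {ν : Measure ℝ}, M.IsSpectralDistribution τ x ν →
      ∀ p : Polynomial ℝ, Integrable (fun t => p.eval t) ν := by
    intro ν hν p
    simp only [Polynomial.eval_eq_sum_range]
    exact integrable_finsetSum _ fun i _ => (hν.integrable_pow i).const_mul _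
  have hpoly : ∀ p : Polynomial ℝ, ∫ t, p.eval t ∂m' = ∫ t, p.eval t ∂m := by
    intro p
    simp only [Polynomial.eval_eq_sum_range]
    rw [integral_finsetSum _ fun i _ => (hm'.integrable_pow i).const_mul _,
      integral_finsetSum _ fun i _ => (hm.integrable_pow i).const_mul _]
    exact Finset.sum_congr rfl fun i _ => by rw [integral_const_mul, integral_const_mul, hmom]
  apply ext_of_forall_integral_eq_of_IsFiniteMeasure
  intro f
  have hclose : ∀ {ν : Measure ℝ}, M.IsSpectralDistribution τ x ν → (∀ᵐ t ∂ν, |t| ≤ R) →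
      ∀ (p : Polynomial ℝ) (ε : ℝ), (∀ t ∈ Icc (-R) R, |p.eval t - f t| < ε) →
      |∫ t, p.eval t ∂ν - ∫ t, f t ∂ν| ≤ ε := by
    intro ν hν hνR p ε hp
    have := hν.isProbabilityMeasure
    rw [← integral_sub (hpint hν p) (f.integrable ν)]
    have := norm_integral_le_of_norm_le_const (μ := ν) (f := fun t => p.eval t - f t) (C := ε)
      (by filter_upwards [hνR] with t ht using (hp t (abs_le.1 ht)).le)
    simpa using this
  refine eq_of_forall_dist_le fun ε hε => ?_
  obtain ⟨p, hp⟩ := exists_polynomial_near_of_continuousOn (-R) R f f.continuous.continuousOn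
    (ε / 2) (half_pos hε)
  have h1 := abs_le.1 (hclose hm hmR p _ hp)
  have h2 := abs_le.1 (hclose hm' hmR' p _ hp)
  rw [hpoly p] at h2
  rw [Real.dist_eq, abs_le]
  constructor <;> linarith [h1.1, h1.2, h2.1, h2.2]

open scoped Classical in
/-- The spectral distribution `m_x` of a self-adjoint element `x` of `M`: the unique Borel
probability measure on the line with `∫ tⁿ dm_x(t) = τ (xⁿ)` for all `n`. -/
def spectralDistribution (M : VonNeumannAlgebra H) (τ : M.toStarSubalgebra →ₗ[ℂ] ℂ)
    (x : M.toStarSubalgebra) : Measure ℝ :=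
  if h : ∃ m, M.IsSpectralDistribution τ x m then h.choose else 0

/-- The eigenvalue function `λ_s(x) = inf {t | m_x((t, ∞)) ≤ s}` of a self-adjoint element. -/
def eigenvalueFunction (M : VonNeumannAlgebra H) (τ : M.toStarSubalgebra →ₗ[ℂ] ℂ)
    (x : M.toStarSubalgebra) (s : ℝ) : ℝ :=
  sInf {t : ℝ | M.spectralDistribution τ x (Ioi t) ≤ ENNReal.ofReal s}

/-- The singular value function `μ_s(x) = λ_s(|x|)`. -/
def singularValueFunction (M : VonNeumannAlgebra H) (τ : M.toStarSubalgebra →ₗ[ℂ] ℂ)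
    (x : M.toStarSubalgebra) (s : ℝ) : ℝ :=
  M.eigenvalueFunction τ (M.absVal x) s

/-- The norm closure in `M` of the two-sided unitary orbit `{U x V | U, V unitaries of M}`. -/
def closedTwoSidedUnitaryOrbit (M : VonNeumannAlgebra H) (x : M.toStarSubalgebra) :
    Set M.toStarSubalgebra :=
  closure {y | ∃ U ∈ unitary M.toStarSubalgebra, ∃ V ∈ unitary M.toStarSubalgebra, y = U * x * V}

end VonNeumannAlgebra

end

/-! Both sides are governed by the moments `τ (|S| ^ n)`. A compactly supported measure is
determined by its moments and, through its tail function, by the generalized inverse of that tail;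
so equality of singular values amounts to equality of all moments of `|S|` and `|T|`
(`singularValueFunction_eq_iff`). Since `|U T V| = V* |T| V`, moments are constant on the orbit, and
by norm continuity of `|·|` and of `τ` also on its closure.

Conversely, let the moments agree. By Weierstrass `τ` agrees on continuous functions of `|S|` and
`|T|`, and by normality on their spectral projections for each half-line `(a, ∞)`
(`map_spectralProjection_eq`). In a factor with faithful trace, projections of equal trace are
equivalent (`projectionEquivalent`): a maximal partial isometry between them can leave a remainder
on at most one side, and equality of traces rules that out too. A positive `x` is within `ε` of `ε ∑
1_(kε, ∞)(x)`, so a unitary `w` matching the two finite decreasing families of projections satisfies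
`w |T| ≈ |S| w` (`exists_unitary_norm_mul_sub_mul_le`). Cutting the polar decomposition off at level
`ε` and completing it to a unitary gives `S ≈ u |S|` and `T ≈ v |T|`
(`exists_unitary_norm_sub_mul_le`). Together, `S ≈ u w v* T w*`.

Spectral projections enter only as supports of `(x - a)⁺`, characterized algebraically by
`IsLeftSupport`. The approximation arguments thus hold in any C⋆-algebra where supports exist and
equal traces imply equivalence. -/

/-- The projection `e` is the left support of `s`. -/
structure IsLeftSupport {A : Type*} [Ring A] [StarRing A] (s e : A) : Prop where
  isStarProjection : IsStarProjection e
  mul_eq : e * s = s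
  mul_eq_zero : ∀ y, y * s = 0 → y * e = 0

/-! ### Order, support projections and central projections in a von Neumann algebra -/

namespace VonNeumannAlgebra

variable {H : Type*} [NormedAddCommGroup H] [InnerProductSpace ℂ H] [CompleteSpace H]

theorem isClosed_toStarSubalgebra (M : VonNeumannAlgebra H) :
    IsClosed (M.toStarSubalgebra : Set (H →L[ℂ] H)) := by
  rw [coe_toStarSubalgebra, ← M.centralizer_centralizer]
  exact Set.isClosed_centralizer _

attribute [local instance] isClosed_toStarSubalgebra

theorem cfc_mem (M : VonNeumannAlgebra H) {x : H →L[ℂ] H} (hx : x ∈ M.toStarSubalgebra)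
    (f : ℝ → ℝ) : cfc f x ∈ M.toStarSubalgebra :=
  M.mem_of_commute_commutant fun _ hy => Commute.cfc_real (mem_commutant_iff.1 hy _ hx) f

/-- The square root of a positive element is a function of it and stays in `M`, so the order
inherited from `H →L[ℂ] H` is the intrinsic one. This opens the abstract C⋆-algebra lemmas to
`M.toStarSubalgebra`. -/
instance starOrderedRing_toStarSubalgebra (M : VonNeumannAlgebra H) :
    StarOrderedRing M.toStarSubalgebra := by
  refine StarOrderedRing.of_nonneg_iff' (fun {x y} h z => ?_) fun x => ⟨fun h => ?_, ?_⟩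
  · exact add_le_add_right (α := H →L[ℂ] H) h z
  · have h' : 0 ≤ (x : H →L[ℂ] H) := h
    have hspec : ∀ t ∈ spectrum ℝ (x : H →L[ℂ] H), 0 ≤ t := fun t ht =>
      spectrum_nonneg_of_nonneg h' ht
    have hmul : cfc Real.sqrt (x : H →L[ℂ] H) * cfc Real.sqrt (x : H →L[ℂ] H) = x := by
      rw [← cfc_mul Real.sqrt Real.sqrt (x : H →L[ℂ] H)]
      conv_rhs => rw [← cfc_id ℝ (x : H →L[ℂ] H)]
      exact cfc_congr fun t ht => Real.mul_self_sqrt (hspec t ht)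
    refine ⟨⟨_, M.cfc_mem x.2 Real.sqrt⟩, Subtype.ext ?_⟩
    have hsa : IsSelfAdjoint (cfc Real.sqrt (x : H →L[ℂ] H)) := cfc_predicate _ _
    change (x : H →L[ℂ] H) = star (cfc Real.sqrt (x : H →L[ℂ] H)) * cfc Real.sqrt (x : H →L[ℂ] H)
    rw [hsa.star_eq, hmul]
  · rintro ⟨s, rfl⟩
    exact star_mul_self_nonneg (s : H →L[ℂ] H)

theorem le_iff_coe_le (M : VonNeumannAlgebra H) {x y : M.toStarSubalgebra} :
    x ≤ y ↔ (x : H →L[ℂ] H) ≤ y := Iff.rfl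

/-- The projection onto a closed subspace that is invariant under the commutant lies in `M`. -/
theorem starProjection_mem (M : VonNeumannAlgebra H) (K : Submodule ℂ H)
    [K.HasOrthogonalProjection] (h : ∀ y ∈ M.commutant, ∀ ξ ∈ K, y ξ ∈ K) :
    K.starProjection ∈ M.toStarSubalgebra := by
  have he : IsStarProjection K.starProjection := isStarProjection_starProjection
  have := (IsStarProjection.mem_iff he M).2 fun y hy => by
    rw [Submodule.range_starProjection]
    exact fun ξ hξ => h y hy ξ hξ
  exact this

theorem starProjection_closure_range_mem (M : VonNeumannAlgebra H) (s : M.toStarSubalgebra) :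
    ((s : H →L[ℂ] H).range).topologicalClosure.starProjection ∈ M.toStarSubalgebra := by
  refine M.starProjection_mem _ fun y hy ξ hξ => ?_
  refine (map_mem_closure (f := y) y.continuous hξ ?_ :)
  rintro _ ⟨ζ, rfl⟩
  refine ⟨y ζ, ?_⟩
  exact congrArg (fun z : H →L[ℂ] H => z ζ) (mem_commutant_iff.1 hy _ s.2)

/-- The projection onto the closure of the range of an element of `M`. -/
noncomputable def leftSupport (M : VonNeumannAlgebra H) (s : M.toStarSubalgebra) :
    M.toStarSubalgebra :=
  ⟨_, M.starProjection_closure_range_mem s⟩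

theorem leftSupport_apply_mem (M : VonNeumannAlgebra H) (s : M.toStarSubalgebra) (ξ : H) :
    (M.leftSupport s : H →L[ℂ] H) ξ ∈ closure (Set.range (s : H →L[ℂ] H)) :=
  Submodule.starProjection_apply_mem ((s : H →L[ℂ] H).range).topologicalClosure ξ

theorem isLeftSupport_leftSupport (M : VonNeumannAlgebra H) (s : M.toStarSubalgebra) :
    IsLeftSupport s (M.leftSupport s) := by
  let K : Submodule ℂ H := ((s : H →L[ℂ] H).range).topologicalClosure
  refine ⟨⟨?_, ?_⟩, ?_, fun y hy => ?_⟩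
  · exact Subtype.ext (isStarProjection_starProjection (U := K)).isIdempotentElem
  · exact Subtype.ext (isStarProjection_starProjection (U := K)).isSelfAdjoint
  · exact Subtype.ext <| ContinuousLinearMap.ext fun ξ =>
      Submodule.starProjection_eq_self_iff.2
        (Submodule.le_topologicalClosure _ (LinearMap.mem_range_self _ ξ))
  · refine Subtype.ext <| ContinuousLinearMap.ext fun ξ => ?_
    have h1 : K ≤ (y : H →L[ℂ] H).ker := by
      refine Submodule.topologicalClosure_minimal _ ?_ (y : H →L[ℂ] H).isClosed_ker
      rintro _ ⟨ζ, rfl⟩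
      exact congrArg (fun z : M.toStarSubalgebra => (z : H →L[ℂ] H) ζ) hy
    exact h1 (Submodule.starProjection_apply_mem K ξ)

/-- A contraction `v` is isometric on `ξ` exactly when `v* v` fixes `ξ`. -/
theorem adjoint_apply_apply_of_norm_eq {v : H →L[ℂ] H} (hv : ∀ ξ, ‖v ξ‖ ≤ ‖ξ‖) {ξ : H}
    (h : ‖v ξ‖ = ‖ξ‖) : (star v * v) ξ = ξ := by
  have h0 : ‖star v (v ξ)‖ ≤ ‖ξ‖ := by
    have h1 : ‖v‖ ≤ 1 := v.opNorm_le_bound zero_le_one fun ξ => by simpa using hv ξ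
    calc ‖star v (v ξ)‖ ≤ ‖star v‖ * ‖v ξ‖ := (star v).le_opNorm _
      _ ≤ 1 * ‖v ξ‖ := by rw [norm_star]; gcongr
      _ = ‖ξ‖ := by rw [one_mul, h]
  have h2 : RCLike.re (inner ℂ (star v (v ξ)) ξ) = ‖ξ‖ ^ 2 := by
    rw [ContinuousLinearMap.star_eq_adjoint, ContinuousLinearMap.adjoint_inner_left,
      inner_self_eq_norm_sq, h]
  -- The expansion is `‖v*vξ‖² - 2‖ξ‖² + ‖ξ‖²`, which is at most `0` by `h0`.
  have h3 := norm_sub_sq (𝕜 := ℂ) (star v (v ξ)) ξ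
  rw [h2] at h3
  have h4 : ‖star v (v ξ) - ξ‖ ^ 2 ≤ 0 := by nlinarith [norm_nonneg (star v (v ξ))]
  have h5 : ‖star v (v ξ) - ξ‖ = 0 := by nlinarith [norm_nonneg (star v (v ξ) - ξ)]
  exact sub_eq_zero.1 (norm_eq_zero.1 h5)

/-- Any two nonzero projections of a factor are linked by an element of the factor. -/
theorem IsFactor.exists_mul_mul_ne_zero {M : VonNeumannAlgebra H} (hM : M.IsFactor)
    {p q : M.toStarSubalgebra} (hp : p ≠ 0) (hq : q ≠ 0) : ∃ a, q * a * p ≠ 0 := by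
  by_contra! h
  -- If every `q a p` vanishes, the common kernel `K` of all `q a` contains the range of `p`. It is
  -- invariant under both `M` and its commutant, so its projection is central, hence a scalar `c`;
  -- `p ≠ 0` forces `c = 1`, and the choice `a = 1` then gives `q = 0`.
  let K : Submodule ℂ H :=
    ⨅ a : M.toStarSubalgebra, ((q * a : M.toStarSubalgebra) : H →L[ℂ] H).ker
  have hK : ∀ ξ, ξ ∈ K ↔ ∀ a : M.toStarSubalgebra,
      ((q * a : M.toStarSubalgebra) : H →L[ℂ] H) ξ = 0 := fun ξ => by
    simp [K, Submodule.mem_iInf]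
  have hKc : IsClosed (K : Set H) := by
    have : (K : Set H) = ⋂ a : M.toStarSubalgebra,
        (((q * a : M.toStarSubalgebra) : H →L[ℂ] H).ker : Set H) := by
      simp [K]
    rw [this]
    exact isClosed_iInter fun a => ContinuousLinearMap.isClosed_ker _
  have : CompleteSpace K := hKc.completeSpace_coe
  have h1 : K.starProjection ∈ M.toStarSubalgebra := by
    refine M.starProjection_mem K fun y hy ξ hξ => (hK _).2 fun a => ?_
    have h2 := congrArg (fun z : H →L[ℂ] H => z ξ) (mem_commutant_iff.1 hy _ (q * a).2)
    have h3 : ((q * a : M.toStarSubalgebra) : H →L[ℂ] H) (y ξ) =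
      y (((q * a : M.toStarSubalgebra) : H →L[ℂ] H) ξ) := h2
    rw [h3, (hK ξ).1 hξ a, map_zero]
  have h2 : K.starProjection ∈ M.commutant.toStarSubalgebra := by
    refine M.commutant.starProjection_mem K fun y hy ξ hξ => (hK _).2 fun a => ?_
    rw [commutant_commutant] at hy
    have h3 := (hK ξ).1 hξ (a * ⟨y, hy⟩)
    rw [← mul_assoc] at h3
    exact h3
  obtain ⟨c, hc⟩ := hM.center_eq_scalars ⟨_, h1⟩ fun x =>
    Subtype.ext (mem_commutant_iff.1 h2 _ x.2).symm
  have hc' : ∀ ξ, K.starProjection ξ = c • ξ := fun ξ =>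
    congrArg (fun z : M.toStarSubalgebra => (z : H →L[ℂ] H) ξ) hc
  have hpK : ∀ ξ, (p : H →L[ℂ] H) ξ ∈ K := fun ξ => (hK _).2 fun a =>
    congrArg (fun z : M.toStarSubalgebra => (z : H →L[ℂ] H) ξ) (h a)
  have hex : ∃ ξ, (p : H →L[ℂ] H) ξ ≠ 0 := by
    by_contra! h0
    exact hp (Subtype.ext (ContinuousLinearMap.ext h0))
  obtain ⟨ξ, hξ⟩ := hex
  have h4 := (hc' _).symm.trans (Submodule.starProjection_eq_self_iff.2 (hpK ξ))
  have hc1 : c = 1 := by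
    have h5 : (c - 1) • (p : H →L[ℂ] H) ξ = 0 := by rw [sub_smul, h4, one_smul, sub_self]
    rcases smul_eq_zero.1 h5 with h6 | h6
    · exact sub_eq_zero.1 h6
    · exact absurd h6 hξ
  refine hq (Subtype.ext <| ContinuousLinearMap.ext fun ζ => ?_)
  have h7 : ζ ∈ K := Submodule.starProjection_eq_self_iff.1 (by rw [hc', hc1, one_smul])
  have h8 := (hK ζ).1 h7 1
  rwa [mul_one] at h8

end VonNeumannAlgebra

/-! ### Partial isometries and the extension order -/

/-- The relation that the partial isometry `w` extends the partial isometry `v`. -/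
def PartialIsometryExtends {A : Type*} [Mul A] [Star A] (v w : A) : Prop :=
  w * (star v * v) = v

section

variable {A : Type*} [Ring A] [StarRing A]

theorem isStarProjection_star_mul_self {v : A} (hv : v * star v * v = v) :
    IsStarProjection (star v * v) :=
  ⟨by rw [IsIdempotentElem, mul_assoc, ← mul_assoc v, hv], IsSelfAdjoint.star_mul_self v⟩

theorem isStarProjection_mul_star_self {v : A} (hv : v * star v * v = v) :
    IsStarProjection (v * star v) :=
  ⟨by rw [IsIdempotentElem, ← mul_assoc, hv], IsSelfAdjoint.mul_star_self v⟩

theorem PartialIsometryExtends.refl {u : A} (hu : u * star u * u = u) :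
    PartialIsometryExtends u u := by
  unfold PartialIsometryExtends
  rw [← mul_assoc, hu]

end

section

variable {A : Type*} [NormedRing A] [StarRing A] [CStarRing A]

/-- With `e = v* v`, the defect `d = v e - v` has `d* d = e³ - 2e² + e = 0`, so `d = 0` by the
C⋆-identity. -/
theorem mul_star_self_mul_of_isStarProjection {v : A} (hv : IsStarProjection (star v * v)) :
    v * star v * v = v := by
  have h1 : star (v * star v * v - v) * (v * star v * v - v) = 0 := by
    have h2 : star v * v * (star v * v) = star v * v := hv.isIdempotentElem
    have h3 : star (v * star v * v - v) * (v * star v * v - v) =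
        star v * v * (star v * v) * (star v * v) - star v * v * (star v * v)
          - star v * v * (star v * v) + star v * v := by
      simp only [star_sub, star_mul, star_star]
      noncomm_ring
    rw [h3, h2, h2]
    abel
  exact sub_eq_zero.1 (CStarRing.star_mul_self_eq_zero_iff _ |>.1 h1)

/-- Write `P = v* v` and `W = w* w`. From `w P = v` comes `P W P = P`, and then `(W P - P)* (W P -
P) = 0`: the initial space grows under extension. -/
theorem PartialIsometryExtends.star_mul_self_mul {v w : A} (hv : v * star v * v = v)
    (hw : w * star w * w = w) (h : PartialIsometryExtends v w) :
    star w * w * (star v * v) = star v * v := by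
  have hP : star v * v * (star v * v) = star v * v :=
    (isStarProjection_star_mul_self hv).isIdempotentElem
  have hW : star w * w * (star w * w) = star w * w :=
    (isStarProjection_star_mul_self hw).isIdempotentElem
  have hPWP : star v * v * (star w * w) * (star v * v) = star v * v := by
    have h1 : star (w * (star v * v)) * (w * (star v * v)) = star v * v := by rw [h]
    simpa [mul_assoc] using h1
  have h2 : star (star w * w * (star v * v) - star v * v) *
      (star w * w * (star v * v) - star v * v) = 0 := by
    have h3 : star (star w * w * (star v * v) - star v * v) *
        (star w * w * (star v * v) - star v * v) =
        star v * v * (star w * w * (star w * w)) * (star v * v)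
          - star v * v * (star w * w) * (star v * v)
          - star v * v * (star w * w) * (star v * v) + star v * v * (star v * v) := by
      simp only [star_sub, star_mul, star_star]
      noncomm_ring
    rw [h3, hW, hPWP, hP]
    abel
  exact sub_eq_zero.1 (CStarRing.star_mul_self_eq_zero_iff _ |>.1 h2)

/-- Supplies `⟨v ξ, w ξ⟩ = ‖v ξ‖²`, the orthogonality that makes `‖v ξ‖` increase along extensions.
-/
theorem PartialIsometryExtends.star_mul_eq {v w : A} (hv : v * star v * v = v)
    (hw : w * star w * w = w) (h : PartialIsometryExtends v w) :
    star v * w = star v * v := by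
  have h1 := congrArg star (h.star_mul_self_mul hv hw)
  have h2 : star (w * (star v * v)) = star v := congrArg star h
  simp only [star_mul, star_star] at h1 h2
  rw [mul_assoc] at h2
  calc star v * w = star v * v * (star w * w) := by
        conv_lhs => rw [← h2]
        simp only [mul_assoc]
    _ = star v * v := h1

theorem PartialIsometryExtends.trans {u v w : A} (hu : u * star u * u = u)
    (hv : v * star v * v = v) (huv : PartialIsometryExtends u v)
    (hvw : PartialIsometryExtends v w) : PartialIsometryExtends u w := by
  have h1 := huv.star_mul_self_mul hu hv
  unfold PartialIsometryExtends at *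
  rw [← h1, ← mul_assoc, hvw, huv]

end

/-! ### Strong limits: approximate units and directed families of partial isometries -/

namespace VonNeumannAlgebra

attribute [local instance] isClosed_toStarSubalgebra

open Filter Topology

variable {H : Type*} [NormedAddCommGroup H] [InnerProductSpace ℂ H]

theorem norm_apply_le_of_norm_le_one {v : H →L[ℂ] H} (hv : ‖v‖ ≤ 1) (ξ : H) : ‖v ξ‖ ≤ ‖ξ‖ :=
  (v.le_of_opNorm_le hv ξ).trans_eq (one_mul _)

variable [CompleteSpace H]

theorem norm_le_one_of_mul_star_self_mul {v : H →L[ℂ] H} (hv : v * star v * v = v) :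
    ‖v‖ ≤ 1 := by
  have h1 := (isStarProjection_star_mul_self hv).norm_le
  rw [CStarRing.norm_star_mul_self] at h1
  nlinarith [norm_nonneg v]

/-- The support of `s` is the least upper bound of an approximate unit `F n` for `s`. -/
theorem isLUB_range_leftSupport (M : VonNeumannAlgebra H) {s : M.toStarSubalgebra}
    {F : ℕ → M.toStarSubalgebra} (h0 : ∀ n, 0 ≤ F n) (h1 : ∀ n, F n ≤ M.leftSupport s)
    (hlim : Tendsto (fun n => F n * s) atTop (𝓝 s)) :
    IsLUB (Set.range F) (M.leftSupport s) := by
  refine ⟨by rintro _ ⟨n, rfl⟩; exact h1 n, fun y hy => ?_⟩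
  set e := M.leftSupport s with he
  have hep : IsStarProjection e := (M.isLeftSupport_leftSupport s).isStarProjection
  have hFe : ∀ n, F n * e = F n := fun n =>
    (IsStarProjection.mul_right_and_mul_left_of_nonneg_of_le hep (h0 n) (h1 n)).1
  have hn : ∀ n, ‖(F n : H →L[ℂ] H)‖ ≤ 1 := fun n =>
    (CStarAlgebra.norm_le_one_iff_of_nonneg (F n) (h0 n)).2 ((h1 n).trans hep.le_one)
  -- Strong convergence `F n → e`: as `F n = F n e`, only vectors in the range of `e` matter. These
  -- are limits of vectors `s ζ`, where convergence is the hypothesis, and the `F n` are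
  -- contractions.
  have key : ∀ ξ, Tendsto (fun n => (F n : H →L[ℂ] H) ξ) atTop (𝓝 ((e : H →L[ℂ] H) ξ)) := by
    intro ξ
    have hF : ∀ n, (F n : H →L[ℂ] H) ξ = (F n : H →L[ℂ] H) ((e : H →L[ℂ] H) ξ) := fun n =>
      (congrArg (fun z : M.toStarSubalgebra => (z : H →L[ℂ] H) ξ) (hFe n)).symm
    simp only [hF]
    set η := (e : H →L[ℂ] H) ξ
    rw [Metric.tendsto_nhds]
    intro ε hε
    obtain ⟨_, ⟨ζ, rfl⟩, hζ⟩ := Metric.mem_closure_iff.1 (M.leftSupport_apply_mem s ξ) (ε / 3)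
      (by positivity)
    have hlimζ : Tendsto (fun n => ((F n * s : M.toStarSubalgebra) : H →L[ℂ] H) ζ) atTop
        (𝓝 ((s : H →L[ℂ] H) ζ)) :=
      ((ContinuousLinearMap.apply ℂ H ζ).continuous.tendsto _).comp
        ((continuous_subtype_val.tendsto _).comp hlim)
    filter_upwards [Metric.tendsto_nhds.1 hlimζ (ε / 3) (by positivity)] with n hnζ
    have h3 : dist ((F n : H →L[ℂ] H) η) ((F n : H →L[ℂ] H) ((s : H →L[ℂ] H) ζ)) < ε / 3 := by
      rw [dist_eq_norm, ← map_sub]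
      refine (norm_apply_le_of_norm_le_one (hn n) _).trans_lt ?_
      rwa [← dist_eq_norm]
    have h4 : dist ((F n : H →L[ℂ] H) ((s : H →L[ℂ] H) ζ)) ((s : H →L[ℂ] H) ζ) < ε / 3 := hnζ
    have h5 : dist ((s : H →L[ℂ] H) ζ) η < ε / 3 := by rw [dist_comm]; exact hζ
    linarith [dist_triangle4 ((F n : H →L[ℂ] H) η) ((F n : H →L[ℂ] H) ((s : H →L[ℂ] H) ζ))
      ((s : H →L[ℂ] H) ζ) η]
  have hyF : ∀ n, F n ≤ y := fun n => hy ⟨n, rfl⟩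
  have hy0 : IsSelfAdjoint y := IsSelfAdjoint.of_nonneg ((h0 0).trans (hyF 0))
  rw [le_iff_coe_le, ContinuousLinearMap.le_def, ContinuousLinearMap.isPositive_def']
  refine ⟨congrArg Subtype.val (hy0.sub hep.isSelfAdjoint).star_eq, fun ξ => ?_⟩
  have hlim2 : Tendsto (fun n => (((y : H →L[ℂ] H) - (F n : H →L[ℂ] H)).reApplyInnerSelf ξ)) atTop
      (𝓝 (((y : H →L[ℂ] H) - (e : H →L[ℂ] H)).reApplyInnerSelf ξ)) := by
    have h6 : Tendsto (fun n => (y : H →L[ℂ] H) ξ - (F n : H →L[ℂ] H) ξ) atTop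
      (𝓝 ((y : H →L[ℂ] H) ξ - (e : H →L[ℂ] H) ξ)) := tendsto_const_nhds.sub (key ξ)
    exact (Complex.continuous_re.tendsto _).comp (h6.inner tendsto_const_nhds)
  refine ge_of_tendsto' hlim2 fun n => ?_
  have h7 := (M.le_iff_coe_le).1 (hyF n)
  rw [ContinuousLinearMap.le_def] at h7
  exact (ContinuousLinearMap.isPositive_def'.1 h7).2 ξ

/-- A directed family of partial isometries has an upper bound. -/
theorem exists_partialIsometry_upperBound (M : VonNeumannAlgebra H) {ι : Type*} [Preorder ι]
    [IsDirectedOrder ι] [Nonempty ι] {x : ι → M.toStarSubalgebra}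
    (hpi : ∀ i, x i * star (x i) * x i = x i)
    (hx : ∀ i j, i ≤ j → PartialIsometryExtends (x i) (x j)) :
    ∃ w : M.toStarSubalgebra, w * star w * w = w ∧ (∀ i, PartialIsometryExtends (x i) w) ∧
      (∀ p, (∀ i, x i * p = x i) → w * p = w) ∧ (∀ q, (∀ i, q * x i = x i) → q * w = w) := by
  let op : ι → H →L[ℂ] H := fun i => (x i : H →L[ℂ] H)
  have hop : ∀ v : ι, op v * star (op v) * op v = op v := fun v =>
    congrArg Subtype.val (hpi v)
  have hnorm : ∀ (v : ι) ξ, ‖op v ξ‖ ≤ ‖ξ‖ := fun v =>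
    norm_apply_le_of_norm_le_one (norm_le_one_of_mul_star_self_mul (hop v))
  have hext : ∀ {v w : ι}, v ≤ w → PartialIsometryExtends (op v) (op w) := fun {v w} h =>
    congrArg Subtype.val (hx v w h)
  -- Pythagoras turns the bounded increasing net `‖op v ξ‖²` into a Cauchy net of vectors, so the
  -- pointwise limit exists.
  have hpyth : ∀ {v w : ι}, v ≤ w → ∀ ξ, ‖op w ξ - op v ξ‖ ^ 2 = ‖op w ξ‖ ^ 2 - ‖op v ξ‖ ^ 2 := by
    intro v w h ξ
    have h1 := (hext h).star_mul_eq (hop v) (hop w)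
    have h2 : inner ℂ (op v ξ) (op w ξ) = inner ℂ (op v ξ) (op v ξ) := by
      have h3 := congrArg (fun z : H →L[ℂ] H => inner ℂ ξ (z ξ)) h1
      simpa [ContinuousLinearMap.star_eq_adjoint, ContinuousLinearMap.adjoint_inner_right] using h3
    have h4 : RCLike.re (inner ℂ (op w ξ) (op v ξ)) = ‖op v ξ‖ ^ 2 := by
      rw [inner_re_symm, h2, inner_self_eq_norm_sq]
    rw [norm_sub_sq (𝕜 := ℂ), h4]
    ring
  have hlim : ∀ ξ, ∃ η, Tendsto (fun v => op v ξ) atTop (𝓝 η) := by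
    intro ξ
    have hbdd : BddAbove (Set.range fun v => ‖op v ξ‖ ^ 2) := by
      refine ⟨‖ξ‖ ^ 2, ?_⟩
      rintro _ ⟨v, rfl⟩
      exact pow_le_pow_left₀ (norm_nonneg _) (hnorm v ξ) 2
    refine CompleteSpace.complete (Metric.cauchy_iff.2 ⟨inferInstance, fun ε hε => ?_⟩)
    obtain ⟨v, hv⟩ := exists_lt_of_lt_ciSup
      (show (⨆ v, ‖op v ξ‖ ^ 2) - (ε / 2) ^ 2 < ⨆ v, ‖op v ξ‖ ^ 2 by
        linarith [sq_pos_of_pos (half_pos hε)])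
    have hd : ∀ w, v ≤ w → dist (op w ξ) (op v ξ) < ε / 2 := by
      intro w hw
      rw [dist_eq_norm]
      refine lt_of_pow_lt_pow_left₀ 2 (by positivity) ?_
      rw [hpyth hw ξ]
      have := le_ciSup hbdd w
      linarith
    refine ⟨(fun v => op v ξ) '' Set.Ici v, image_mem_map (Ici_mem_atTop v), ?_⟩
    rintro _ ⟨w, hw, rfl⟩ _ ⟨u, hu, rfl⟩
    have h1 := hd w hw
    have h2 := hd u hu
    have h3 := dist_triangle_right (op w ξ) (op u ξ) (op v ξ)
    linarith
  choose g hg using hlim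
  let w₀ : H →ₗ[ℂ] H := linearMapOfTendsto g (fun v => (op v : H →ₗ[ℂ] H)) (tendsto_pi_nhds.2 hg)
  let w : H →L[ℂ] H := w₀.mkContinuous 1 fun ξ => by
    rw [one_mul]
    exact le_of_tendsto' (hg ξ).norm fun v => hnorm v ξ
  have hw : ∀ ξ, Tendsto (fun v => op v ξ) atTop (𝓝 (w ξ)) := hg
  have hwnorm : ∀ ξ, ‖w ξ‖ ≤ ‖ξ‖ := fun ξ => le_of_tendsto' (hw ξ).norm fun v => hnorm v ξ
  have hmem : w ∈ M.toStarSubalgebra := by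
    refine M.mem_of_commute_commutant fun y hy => ContinuousLinearMap.ext fun ξ => ?_
    refine tendsto_nhds_unique (hw (y ξ)) ?_
    have h1 := ((y.continuous.tendsto _).comp (hw ξ))
    refine h1.congr fun v => ?_
    exact (congrArg (fun z : H →L[ℂ] H => z ξ) (mem_commutant_iff.1 hy _ (x v).2)).symm
  have hwext : ∀ v : ι, w * (star (op v) * op v) = op v := by
    intro v
    refine ContinuousLinearMap.ext fun ξ => tendsto_nhds_unique (hw _) ?_
    refine tendsto_const_nhds.congr' ?_
    filter_upwards [Ici_mem_atTop v] with u hu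
    exact (congrArg (fun z : H →L[ℂ] H => z ξ) (hext hu)).symm
  -- On the initial space of `op v` the contraction `w` agrees with `op v`, so it is isometric
  -- there.
  have hfix : ∀ v : ι, star w * w * (star (op v) * op v) = star (op v) * op v := by
    intro v
    refine ContinuousLinearMap.ext fun ξ => ?_
    refine adjoint_apply_apply_of_norm_eq hwnorm (ξ := (star (op v) * op v) ξ) ?_
    refine le_antisymm (hwnorm _) ?_
    have h1 : w ((star (op v) * op v) ξ) = op v ξ :=
      congrArg (fun z : H →L[ℂ] H => z ξ) (hwext v)
    rw [h1]
    have h2 : ‖star (op v)‖ ≤ 1 := by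
      rw [norm_star]
      exact norm_le_one_of_mul_star_self_mul (hop v)
    exact norm_apply_le_of_norm_le_one h2 _
  have hwv : ∀ v : ι, w * star w * op v = op v := by
    intro v
    calc w * star w * op v = w * star w * (w * (star (op v) * op v)) := by rw [hwext]
      _ = w * (star w * w * (star (op v) * op v)) := by simp only [mul_assoc]
      _ = op v := by rw [hfix, hwext]
  refine ⟨⟨w, hmem⟩, Subtype.ext <| ContinuousLinearMap.ext fun ξ => ?_, fun v =>
    Subtype.ext (hwext v), fun p hp => Subtype.ext <| ContinuousLinearMap.ext fun ξ => ?_,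
    fun q hq => Subtype.ext <| ContinuousLinearMap.ext fun ξ => ?_⟩
  · refine tendsto_nhds_unique (((w * star w).continuous.tendsto _).comp (hw ξ)) ?_
    refine (hw ξ).congr fun v => ?_
    exact (congrArg (fun z : H →L[ℂ] H => z ξ) (hwv v)).symm
  · refine tendsto_nhds_unique (hw ((p : H →L[ℂ] H) ξ)) ((hw ξ).congr fun v => ?_)
    exact (congrArg (fun z : M.toStarSubalgebra => (z : H →L[ℂ] H) ξ) (hp v)).symm
  · refine tendsto_nhds_unique (((q : H →L[ℂ] H).continuous.tendsto _).comp (hw ξ))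
      ((hw ξ).congr fun v => ?_)
    exact (congrArg (fun z : M.toStarSubalgebra => (z : H →L[ℂ] H) ξ) (hq v)).symm

end VonNeumannAlgebra

/-! ### Algebra of left supports -/

theorem IsLeftSupport.isSelfAdjoint_mul_eq {A : Type*} [Ring A] [StarRing A] {s e : A}
    (he : IsLeftSupport s e) (hs : IsSelfAdjoint s) : s * e = s := by
  have := congrArg star he.mul_eq
  rwa [star_mul, hs.star_eq, he.isStarProjection.isSelfAdjoint.star_eq] at this

/-- The element `z - e z` kills `s` because `z s = s z = e s z`; hence it kills `e`, so `z e = e z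
e`, and taking adjoints gives `e z = e z e`. -/
theorem IsLeftSupport.commute {A : Type*} [Ring A] [StarRing A] {s e z : A}
    (he : IsLeftSupport s e) (hz : IsSelfAdjoint z) (h : Commute z s) : Commute e z := by
  have h1 : (z - e * z) * e = 0 := by
    refine he.mul_eq_zero _ ?_
    rw [sub_mul, mul_assoc, h.eq, ← mul_assoc, he.mul_eq, sub_self]
  have h2 : z * e = e * z * e := by rwa [sub_mul, sub_eq_zero] at h1
  have h3 := congrArg star h2
  simp only [star_mul, hz.star_eq, he.isStarProjection.isSelfAdjoint.star_eq] at h3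
  rw [Commute, SemiconjBy, h2, mul_assoc, ← h3]

/-- An annihilator of `t`, here `1 - e`, annihilates its support. Monotonicity of spectral
projections and uniqueness of supports both reduce to this. -/
theorem IsLeftSupport.mul_eq_of_mul_eq {A : Type*} [Ring A] [StarRing A] {e t f : A}
    (hf : IsLeftSupport t f) (h : e * t = t) : e * f = f := by
  have := hf.mul_eq_zero (1 - e) (by rw [sub_mul, one_mul, h, sub_self])
  rw [sub_mul, one_mul, sub_eq_zero] at this
  exact this.symm

theorem IsLeftSupport.unique {A : Type*} [Ring A] [StarRing A] {s e f : A}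
    (he : IsLeftSupport s e) (hf : IsLeftSupport s f) : e = f := by
  have h1 : e * f = f := IsLeftSupport.mul_eq_of_mul_eq hf he.mul_eq
  have h2 : f * e = e := IsLeftSupport.mul_eq_of_mul_eq he hf.mul_eq
  have h3 := congrArg star h1
  rw [star_mul, he.isStarProjection.isSelfAdjoint.star_eq,
    hf.isStarProjection.isSelfAdjoint.star_eq, h2] at h3
  exact h3

/-! ### Spectral projections, step approximation and truncated polar decomposition -/

section Spectral

variable {A : Type*} [CStarAlgebra A]

/-- The projection `e` is the spectral projection of `x` for the interval `(a, ∞)`. -/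
def IsSpectralProjection (x : A) (a : ℝ) (e : A) : Prop :=
  IsLeftSupport (cfc (fun t : ℝ => max (t - a) 0) x) e

/-- The product of `g` with `(t - a)⁺` vanishes on the spectrum, so `g(x)` annihilates `(x - a)⁺`
and therefore its support. Identities valid for `t > a` become identities after multiplication by
`e`. -/
theorem IsSpectralProjection.cfc_mul_eq_zero {x e : A} {a : ℝ} (he : IsSpectralProjection x a e)
    {g : ℝ → ℝ} (hg : Continuous g) (h : ∀ t ∈ spectrum ℝ x, a < t → g t = 0) :
    cfc g x * e = 0 := by
  refine IsLeftSupport.mul_eq_zero he _ ?_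
  rw [← cfc_mul g (fun t : ℝ => max (t - a) 0) x (by fun_prop) (by fun_prop),
    cfc_congr (g := fun _ => (0 : ℝ)), cfc_const_zero]
  intro t ht
  rcases le_or_gt t a with hta | hta
  · simp [max_eq_right (sub_nonpos.2 hta)]
  · simp [h t ht hta]

theorem IsSpectralProjection.mul_cfc {x e : A} {a b : ℝ} (he : IsSpectralProjection x a e)
    (hab : a ≤ b) :
    e * cfc (fun t : ℝ => max (t - b) 0) x = cfc (fun t : ℝ => max (t - b) 0) x := by
  rcases hab.eq_or_lt with rfl | hab
  · exact IsLeftSupport.mul_eq he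
  -- Flooring the denominator at `b - a` keeps the quotient continuous; it changes nothing for `t >
  -- b`, where the numerator is nonzero.
  have hpos : ∀ t : ℝ, 0 < max (t - a) (b - a) := fun t => lt_max_of_lt_right (sub_pos.2 hab)
  have hc : Continuous fun t : ℝ => max (t - b) 0 / max (t - a) (b - a) :=
    Continuous.div (by fun_prop) (by fun_prop) fun t => (hpos t).ne'
  have h1 : cfc (fun t : ℝ => max (t - b) 0) x = cfc (fun t : ℝ => max (t - a) 0) x *
      cfc (fun t : ℝ => max (t - b) 0 / max (t - a) (b - a)) x := by
    rw [← cfc_mul (fun t : ℝ => max (t - a) 0) _ x (by fun_prop) hc.continuousOn]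
    refine cfc_congr fun t _ => ?_
    rcases le_or_gt t b with htb | htb
    · simp [max_eq_right (sub_nonpos.2 htb)]
    · have h2 : max (t - a) (b - a) = t - a := max_eq_left (by linarith)
      have h3 : max (t - a) 0 = t - a := max_eq_left (by linarith)
      have h4 : t - a ≠ 0 := by linarith
      simp only [h2, h3]
      field_simp
  rw [h1, ← mul_assoc, IsLeftSupport.mul_eq he]

theorem IsSpectralProjection.mul_eq {x e f : A} {a b : ℝ} (he : IsSpectralProjection x a e)
    (hf : IsSpectralProjection x b f) (hab : a ≤ b) : e * f = f :=
  IsLeftSupport.mul_eq_of_mul_eq hf (he.mul_cfc hab)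

theorem IsSpectralProjection.eq_zero_of_norm_le {x e : A} {a : ℝ}
    (he : IsSpectralProjection x a e) (hxa : ‖x‖ ≤ a) :
    cfc (fun t : ℝ => max (t - a) 0) x = 0 ∧ e = 0 := by
  rcases subsingleton_or_nontrivial A with hA | hA
  · exact ⟨Subsingleton.elim _ _, Subsingleton.elim _ _⟩
  have h : cfc (fun t : ℝ => max (t - a) 0) x = 0 := by
    rw [cfc_congr (g := fun _ => (0 : ℝ)), cfc_const_zero]
    intro t ht
    have : t ≤ ‖x‖ := (le_abs_self t).trans (spectrum.norm_le_norm_of_mem ht)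
    exact max_eq_right (by linarith)
  refine ⟨h, ?_⟩
  have := IsLeftSupport.mul_eq_zero he 1 (by rw [h, mul_zero])
  rwa [one_mul] at this

variable [PartialOrder A] [StarOrderedRing A]

/-- The slice of `x` between the levels `a` and `a + ε` lies between multiples of the spectral
projections for these levels. -/
theorem IsSpectralProjection.smul_le_slice_le {x e f : A} {a b : ℝ}
    (he : IsSpectralProjection x a e) (hf : IsSpectralProjection x b f) (hab : a ≤ b) :
    (b - a) • f ≤ cfc (fun t : ℝ => max (t - a) 0) x - cfc (fun t : ℝ => max (t - b) 0) x ∧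
    cfc (fun t : ℝ => max (t - a) 0) x - cfc (fun t : ℝ => max (t - b) 0) x ≤ (b - a) • e := by
  have hes := (IsLeftSupport.isStarProjection he)
  have hfs := (IsLeftSupport.isStarProjection hf)
  set G := cfc (fun t : ℝ => max (t - a) 0) x - cfc (fun t : ℝ => max (t - b) 0) x with hG
  have hGc : G = cfc (fun t : ℝ => max (t - a) 0 - max (t - b) 0) x :=
    (cfc_sub (fun t : ℝ => max (t - a) 0) (fun t : ℝ => max (t - b) 0) x).symm
  have hGsa : IsSelfAdjoint G := by rw [hGc]; exact cfc_predicate _ _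
  by_cases hx : IsSelfAdjoint x
  swap
  -- For `x` not self-adjoint `cfc` takes its default value `0`, and all supports are `0`.
  · have h0 : ∀ g : ℝ → ℝ, cfc g x = 0 := fun g => cfc_apply_of_not_predicate x hx
    have h1 : ∀ {c : ℝ} {p : A}, IsSpectralProjection x c p → p = 0 := fun {c p} hp => by
      have := IsLeftSupport.mul_eq_zero hp 1 (by rw [h0, mul_zero])
      rwa [one_mul] at this
    rw [hG, h0, h0, h1 he, h1 hf]
    simp
  have hG0 : 0 ≤ G := by
    rw [hGc]
    exact cfc_nonneg fun t _ => sub_nonneg.2 (max_le_max (by linarith) le_rfl)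
  have hG1 : G ≤ algebraMap ℝ A (b - a) := by
    rw [hGc]
    refine cfc_le_algebraMap _ _ _ fun t _ => ?_
    rcases le_total t a with h1 | h1 <;> rcases le_total t b with h2 | h2 <;>
      simp [h1, h2] <;> linarith
  constructor
  · have h1 : G * f = (b - a) • f := by
      have h2 := hf.cfc_mul_eq_zero (g := fun t => (max (t - a) 0 - max (t - b) 0) - (b - a))
        (by fun_prop) (fun t _ ht => by
          rw [max_eq_left (by linarith), max_eq_left (by linarith)]; ring)
      rw [cfc_sub (fun t : ℝ => max (t - a) 0 - max (t - b) 0) (fun _ => b - a) x, ← hGc,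
        cfc_const _ _, sub_mul, sub_eq_zero] at h2
      rw [h2, Algebra.smul_def]
    have h3 : f * G = (b - a) • f := by
      have := congrArg star h1
      simpa [hGsa.star_eq, hfs.isSelfAdjoint.star_eq] using this
    -- Since `G` acts as `b - a` on `f`, subtracting `(b - a) f` leaves the compression of `G ≥ 0`
    -- to `1 - f`.
    have h4 : G - (b - a) • f = (1 - f) * G * star (1 - f) := by
      rw [hfs.one_sub.isSelfAdjoint.star_eq]
      have h5 : (1 - f) * G * (1 - f) = G - f * G - G * f + f * G * f := by noncomm_ring
      rw [h5, h1, h3, smul_mul_assoc, hfs.isIdempotentElem.eq]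
      abel
    rw [← sub_nonneg, h4]
    exact star_right_conjugate_nonneg hG0 _
  · have h1 : e * G = G := by
      rw [hG, mul_sub, he.mul_cfc le_rfl, he.mul_cfc hab]
    have h2 : G * e = G := by
      have := congrArg star h1
      simpa [hGsa.star_eq, hes.isSelfAdjoint.star_eq] using this
    have h3 := star_right_conjugate_le_conjugate hG1 e
    rw [hes.isSelfAdjoint.star_eq, h1, h2, ← Algebra.commutes, mul_assoc,
      hes.isIdempotentElem.eq, ← Algebra.smul_def] at h3
    exact h3

/-- A positive element is uniformly close to a step function of it. -/
theorem norm_sub_smul_sum_le {x : A} (hx : 0 ≤ x) {ε : ℝ} (hε : 0 < ε) {P : ℕ → A}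
    (hP : ∀ k : ℕ, IsSpectralProjection x (k * ε) (P k)) {N : ℕ} (hN : ‖x‖ ≤ N * ε) :
    ‖x - ε • ∑ k ∈ Finset.range N, P k‖ ≤ ε := by
  set G : ℕ → A := fun k => cfc (fun t : ℝ => max (t - k * ε) 0) x with hG
  have hslice : ∀ k, ε • P (k + 1) ≤ G k - G (k + 1) ∧ G k - G (k + 1) ≤ ε • P k := by
    intro k
    have h1 := (hP k).smul_le_slice_le (hP (k + 1)) (by push_cast; linarith)
    have h2 : ((k + 1 : ℕ) : ℝ) * ε - k * ε = ε := by push_cast; ring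
    rwa [h2] at h1
  have h0 : G 0 = x := by
    rw [hG]
    conv_rhs => rw [← cfc_id ℝ x]
    refine cfc_congr fun t ht => ?_
    have := spectrum_nonneg_of_nonneg hx ht
    simpa using this
  have hsum : ∑ k ∈ Finset.range N, (G k - G (k + 1)) = x := by
    rw [Finset.sum_range_sub', h0, show G N = 0 from ((hP N).eq_zero_of_norm_le hN).1,
      sub_zero]
  have hle : x ≤ ε • ∑ k ∈ Finset.range N, P k := by
    rw [Finset.smul_sum]
    conv_lhs => rw [← hsum]
    exact Finset.sum_le_sum fun k _ => (hslice k).2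
  have hge : ε • ∑ k ∈ Finset.range N, P (k + 1) ≤ x := by
    rw [Finset.smul_sum]
    conv_rhs => rw [← hsum]
    exact Finset.sum_le_sum fun k _ => (hslice k).1
  -- The lower and upper sums enclosing `x` differ only by `ε P 0 ≤ ε`, because `P N = 0`.
  have htel : ∑ k ∈ Finset.range N, P k = ∑ k ∈ Finset.range N, P (k + 1) + P 0 := by
    have h1 := Finset.sum_range_sub' P N
    rw [((hP N).eq_zero_of_norm_le hN).2, sub_zero, Finset.sum_sub_distrib] at h1
    rw [← h1]; abel
  have hP0 : P 0 ≤ 1 := (IsLeftSupport.isStarProjection (hP 0)).le_one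
  rw [norm_sub_rev, CStarAlgebra.norm_le_iff_le_algebraMap _ hε.le (sub_nonneg.2 hle),
    sub_le_iff_le_add, htel, smul_add, add_comm]
  refine add_le_add ?_ hge
  rw [Algebra.algebraMap_eq_smul_one]
  exact smul_le_smul_of_nonneg_left hP0 hε.le

/-- Truncated polar decomposition. -/
theorem exists_polar_of_isSpectralProjection {S x e : A} (hx : 0 ≤ x) (hS : star S * S = x * x)
    {ε : ℝ} (hε : 0 < ε) (he : IsSpectralProjection x ε e) :
    ∃ z : A, star (S * z) * (S * z) = e ∧ S * z * x = S * e ∧ Commute e x ∧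
      (∃ y, e = y * S) ∧ ‖S * (1 - e)‖ ≤ ε := by
  have hes := IsLeftSupport.isStarProjection he
  have hxsa : IsSelfAdjoint x := .of_nonneg hx
  have hpos : ∀ t : ℝ, 0 < max t ε := fun t => lt_max_of_lt_right hε
  have hgc : Continuous fun t : ℝ => (max t ε)⁻¹ :=
    Continuous.inv₀ (by fun_prop) fun t => (hpos t).ne'
  -- A bounded inverse of `x` on the range of `e`; thus `S g e` is the polar part of `S` cut down to
  -- `e`.
  set g := cfc (fun t : ℝ => (max t ε)⁻¹) x with hg
  have hgsa : IsSelfAdjoint g := cfc_predicate _ _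
  have hcomm : ∀ {w : A}, IsSelfAdjoint w → Commute w x → Commute e w := fun {w} hw h =>
    IsLeftSupport.commute he hw (Commute.cfc_real h.symm _).symm
  have hgx : Commute g x := Commute.cfc_real (Commute.refl x) _
  have hex : Commute e x := hcomm hxsa (Commute.refl x)
  have heg : Commute e g := hcomm hgsa hgx
  have hgxe : g * x * e = e := by
    have h1 := he.cfc_mul_eq_zero (g := fun t => (max t ε)⁻¹ * t - 1)
      (by exact (hgc.mul continuous_id).sub continuous_const)
      (fun t _ ht => by
        rw [max_eq_left ht.le, inv_mul_cancel₀ (hε.trans ht).ne', sub_self])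
    rw [cfc_sub (fun t : ℝ => (max t ε)⁻¹ * t) (fun _ => (1 : ℝ)) x
        (hgc.mul continuous_id).continuousOn (by fun_prop),
      cfc_mul (fun t : ℝ => (max t ε)⁻¹) (fun t => t) x
        hgc.continuousOn (by fun_prop), cfc_id' ℝ x,
      cfc_const_one ℝ x, ← hg, sub_mul, one_mul, sub_eq_zero] at h1
    exact h1
  have hee := hes.isIdempotentElem.eq
  have hxge : x * g * e = e := by rw [← hgx.eq, hgxe]
  have hegx : e * g * x = e := by
    have := congrArg star hxge
    simpa [hxsa.star_eq, hgsa.star_eq, hes.isSelfAdjoint.star_eq, mul_assoc] using this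
  refine ⟨g * e, ?_, ?_, hex, ⟨e * g * g * star S, ?_⟩, ?_⟩
  · calc star (S * (g * e)) * (S * (g * e)) = e * g * (star S * S) * g * e := by
          simp only [star_mul, hgsa.star_eq, hes.isSelfAdjoint.star_eq, mul_assoc]
      _ = (e * g * x) * (x * g * e) := by rw [hS]; simp only [mul_assoc]
      _ = e := by rw [hegx, hxge, hee]
  · rw [mul_assoc, mul_assoc, hex.eq, ← mul_assoc g, hgxe]
  · calc e = e * g * x := hegx.symm
      _ = e * g * x * g * x := by rw [hegx, hegx]
      _ = e * g * (x * g) * x := by simp only [mul_assoc]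
      _ = e * g * (g * x) * x := by rw [hgx.eq]
      _ = e * g * g * (x * x) := by simp only [mul_assoc]
      _ = e * g * g * star S * S := by rw [← hS]; simp only [mul_assoc]
  -- Split `x = min(x, ε) + (x - ε)⁺`; the second summand is supported on `e`.
  · have h1 : x * (1 - e) = cfc (fun t : ℝ => min t ε) x * (1 - e) := by
      have h2 : x = cfc (fun t : ℝ => min t ε) x + cfc (fun t : ℝ => max (t - ε) 0) x := by
        rw [← cfc_add x (fun t : ℝ => min t ε) (fun t : ℝ => max (t - ε) 0)]
        conv_lhs => rw [← cfc_id' ℝ x]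
        refine cfc_congr fun t _ => ?_
        rcases le_total t ε with h | h
        · simp [h]
        · simp [h]
      conv_lhs => rw [h2]
      rw [add_mul, mul_sub (cfc (fun t : ℝ => max (t - ε) 0) x), mul_one,
        IsLeftSupport.isSelfAdjoint_mul_eq he (cfc_predicate _ _), sub_self, add_zero]
    have h3 : ‖S * (1 - e)‖ = ‖x * (1 - e)‖ := by
      have h4 : star (S * (1 - e)) * (S * (1 - e)) = star (x * (1 - e)) * (x * (1 - e)) := by
        simp only [star_mul, hxsa.star_eq]
        calc star (1 - e) * star S * (S * (1 - e)) = star (1 - e) * (star S * S) * (1 - e) := by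
              simp only [mul_assoc]
          _ = _ := by rw [hS]; simp only [mul_assoc]
      have h5 := CStarRing.norm_star_mul_self (x := S * (1 - e))
      rw [h4, CStarRing.norm_star_mul_self] at h5
      exact (mul_self_inj (norm_nonneg _) (norm_nonneg _)).1 h5.symm
    rw [h3, h1]
    have h6 : ‖cfc (fun t : ℝ => min t ε) x‖ ≤ ε := by
      refine norm_cfc_le hε.le fun t ht => ?_
      have := spectrum_nonneg_of_nonneg hx ht
      rw [Real.norm_eq_abs, abs_of_nonneg (le_min this hε.le)]
      exact min_le_right _ _
    calc _ ≤ ‖cfc (fun t : ℝ => min t ε) x‖ * ‖1 - e‖ := norm_mul_le _ _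
      _ ≤ ε * 1 := mul_le_mul h6 hes.one_sub.norm_le (norm_nonneg _) hε.le
      _ = ε := mul_one ε

end Spectral

/-! ### Unitaries assembled from equivalent projections -/

section Unitary

variable {A : Type*} [CStarAlgebra A]

/-- Partial isometries between two finite orthogonal partitions of unity add up to a unitary. -/
theorem exists_unitary_of_orthogonal {e f v : ℕ → A} {N : ℕ}
    (he : ∀ j k, j ≠ k → e j * e k = 0) (hf : ∀ j k, j ≠ k → f j * f k = 0)
    (hep : ∀ k, IsStarProjection (e k)) (hfp : ∀ k, IsStarProjection (f k))
    (he1 : ∑ k ∈ Finset.range N, e k = 1) (hf1 : ∑ k ∈ Finset.range N, f k = 1)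
    (hve : ∀ k, star (v k) * v k = e k) (hvf : ∀ k, v k * star (v k) = f k) :
    ∃ u ∈ unitary A, ∀ k < N, u * e k = f k * u := by
  have hpi : ∀ k, v k * star (v k) * v k = v k := fun k =>
    mul_star_self_mul_of_isStarProjection (by rw [hve]; exact hep k)
  have h1 : ∀ k, v k * e k = v k := fun k => by rw [← hve, ← mul_assoc, hpi]
  have h2 : ∀ k, f k * v k = v k := fun k => by rw [← hvf, hpi]
  have h3 : ∀ k, e k * star (v k) = star (v k) := fun k => by
    have := congrArg star (h1 k)
    rwa [star_mul, (hep k).isSelfAdjoint.star_eq] at this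
  have h4 : ∀ k, star (v k) * f k = star (v k) := fun k => by
    have := congrArg star (h2 k)
    rwa [star_mul, (hfp k).isSelfAdjoint.star_eq] at this
  have h5 : ∀ j k, j ≠ k → star (v j) * v k = 0 := fun j k hjk => by
    rw [← h4 j, ← h2 k, mul_assoc, ← mul_assoc (f j), hf j k hjk, zero_mul, mul_zero]
  have h6 : ∀ j k, j ≠ k → v j * star (v k) = 0 := fun j k hjk => by
    rw [← h1 j, ← h3 k, mul_assoc, ← mul_assoc (e j), he j k hjk, zero_mul, mul_zero]
  refine ⟨∑ k ∈ Finset.range N, v k, ⟨?_, ?_⟩, fun k hk => ?_⟩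
  · rw [star_sum, Finset.sum_mul_sum, ← he1]
    refine Finset.sum_congr rfl fun j hj => ?_
    rw [Finset.sum_eq_single_of_mem j hj fun k _ hk => h5 j k hk.symm, hve]
  · rw [star_sum, Finset.sum_mul_sum, ← hf1]
    refine Finset.sum_congr rfl fun j hj => ?_
    rw [Finset.sum_eq_single_of_mem j hj fun k _ hk => h6 j k hk.symm, hvf]
  · have hk' := Finset.mem_range.2 hk
    rw [Finset.sum_mul, Finset.mul_sum, Finset.sum_eq_single_of_mem k hk',
      Finset.sum_eq_single_of_mem k hk', h1, h2]
    · intro j _ hj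
      rw [← h2 j, ← mul_assoc, hf k j hj.symm, zero_mul]
    · intro j _ hj
      rw [← h1 j, mul_assoc, he j k hj, mul_zero]

/-- Two projections are Murray--von Neumann equivalent. -/
def ProjectionEquivalent (p q : A) : Prop :=
  ∃ v : A, star v * v = p ∧ v * star v = q

theorem orthogonal_sub_succ {p : ℕ → A} (hp : ∀ k, IsStarProjection (p k))
    (hpm : ∀ j k, j ≤ k → p j * p k = p k) :
    (∀ k, IsStarProjection (p k - p (k + 1))) ∧
      ∀ j k, j ≠ k → (p j - p (j + 1)) * (p k - p (k + 1)) = 0 := by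
  have hpm' : ∀ j k, j ≤ k → p k * p j = p k := fun j k h => by
    have := congrArg star (hpm j k h)
    rwa [star_mul, (hp j).isSelfAdjoint.star_eq, (hp k).isSelfAdjoint.star_eq] at this
  refine ⟨fun k => (hp _).sub_of_mul_eq_left (hp _) (hpm' k (k + 1) k.le_succ), fun j k hjk => ?_⟩
  rw [sub_mul, mul_sub, mul_sub]
  rcases lt_or_gt_of_ne hjk with h | h
  · rw [hpm j k h.le, hpm j (k + 1) (by omega), hpm (j + 1) k h, hpm (j + 1) (k + 1) (by omega)]
    abel
  · rw [hpm' k j h.le, hpm' k (j + 1) (by omega), hpm' (k + 1) j h, hpm' (k + 1) (j + 1) (by omega)]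
    abel

/-- Decreasing sequences of projections with equal traces are unitarily equivalent, if projections
with equal traces are equivalent. -/
theorem exists_unitary_of_antitone {τ : A →ₗ[ℂ] ℂ}
    (hcomp : ∀ p q : A, IsStarProjection p → IsStarProjection q → τ p = τ q →
      ProjectionEquivalent p q) {p q : ℕ → A} {N : ℕ}
    (hp : ∀ k, IsStarProjection (p k)) (hq : ∀ k, IsStarProjection (q k))
    (hpm : ∀ j k, j ≤ k → p j * p k = p k) (hqm : ∀ j k, j ≤ k → q j * q k = q k)
    (hp0 : p 0 = 1) (hq0 : q 0 = 1) (hpN : p N = 0) (hqN : q N = 0) (hτ : ∀ k, τ (p k) = τ (q k)) :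
    ∃ u ∈ unitary A, ∀ k ≤ N, u * p k = q k * u := by
  obtain ⟨hep, he⟩ := orthogonal_sub_succ hp hpm
  obtain ⟨hfp, hf⟩ := orthogonal_sub_succ hq hqm
  -- Consecutive differences partition unity on both sides and have equal traces; the chains
  -- themselves are then matched by induction from index `0`.
  choose v hve hvf using fun k => hcomp (p k - p (k + 1)) (q k - q (k + 1)) (hep k) (hfp k)
    (by rw [map_sub, map_sub, hτ, hτ])
  obtain ⟨u, hu, huk⟩ := exists_unitary_of_orthogonal he hf hep hfp (N := N)
    (by rw [Finset.sum_range_sub', hp0, hpN, sub_zero])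
    (by rw [Finset.sum_range_sub', hq0, hqN, sub_zero]) hve hvf
  refine ⟨u, hu, fun k hk => ?_⟩
  induction k with
  | zero => rw [hp0, hq0, mul_one, one_mul]
  | succ k ih =>
    have h1 := huk k hk
    rw [mul_sub, sub_mul, ih (by omega)] at h1
    exact sub_right_injective h1

variable [PartialOrder A] [StarOrderedRing A]

/-- Positive elements whose spectral projections have equal traces are approximately unitarily
equivalent. -/
theorem exists_unitary_norm_mul_sub_mul_le {τ : A →ₗ[ℂ] ℂ}
    (hcomp : ∀ p q : A, IsStarProjection p → IsStarProjection q → τ p = τ q →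
      ProjectionEquivalent p q)
    (hsupp : ∀ s : A, ∃ e, IsLeftSupport s e) {x y : A} (hx : 0 ≤ x) (hy : 0 ≤ y)
    (hτ : ∀ a p q, IsSpectralProjection x a p → IsSpectralProjection y a q → τ p = τ q)
    {ε : ℝ} (hε : 0 < ε) : ∃ u ∈ unitary A, ‖u * x - y * u‖ ≤ 2 * ε := by
  rcases subsingleton_or_nontrivial A with hA | hA
  · exact ⟨1, one_mem _, by rw [Subsingleton.elim (1 * x - y * 1) 0, norm_zero]; positivity⟩
  choose P hP using fun k : ℕ => hsupp (cfc (fun t : ℝ => max (t - k * ε) 0) x)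
  choose Q hQ using fun k : ℕ => hsupp (cfc (fun t : ℝ => max (t - k * ε) 0) y)
  have hP' : ∀ k : ℕ, IsSpectralProjection x (k * ε) (P k) := hP
  have hQ' : ∀ k : ℕ, IsSpectralProjection y (k * ε) (Q k) := hQ
  obtain ⟨N, hN⟩ := exists_nat_ge (max ‖x‖ ‖y‖ / ε)
  rw [div_le_iff₀ hε] at hN
  have hNx := (le_max_left _ _).trans hN
  have hNy := (le_max_right _ _).trans hN
  -- The support `P 0` of `x` need not be `1`, so `1` is put in front: `P k` gets index `k + 1` and
  -- the chain reaches `0` at `N + 1`.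
  have hext : ∀ {z : A} {R : ℕ → A}, (∀ k : ℕ, IsSpectralProjection z (k * ε) (R k)) →
      (∀ k, IsStarProjection (Nat.casesOn k 1 R : A)) ∧
      ∀ j k : ℕ, j ≤ k → (Nat.casesOn j 1 R : A) * (Nat.casesOn k 1 R : A) = Nat.casesOn k 1 R := by
    intro z R hR
    refine ⟨fun k => ?_, fun j k hjk => ?_⟩
    · cases k with
      | zero => exact IsStarProjection.one _
      | succ k => exact IsLeftSupport.isStarProjection (hR k)
    · cases j with
      | zero => exact one_mul _
      | succ j =>
        cases k with
        | zero => omega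
        | succ k =>
          refine (hR j).mul_eq (hR k) ?_
          have : (j : ℝ) ≤ k := by exact_mod_cast Nat.succ_le_succ_iff.1 hjk
          gcongr
  obtain ⟨hp, hpm⟩ := hext hP'
  obtain ⟨hq, hqm⟩ := hext hQ'
  obtain ⟨u, hu, huk⟩ := exists_unitary_of_antitone hcomp (N := N + 1) hp hq hpm hqm rfl rfl
    ((hP' N).eq_zero_of_norm_le hNx).2 ((hQ' N).eq_zero_of_norm_le hNy).2 (fun k => by
      cases k with
      | zero => rfl
      | succ k => exact hτ _ _ _ (hP' k) (hQ' k))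
  refine ⟨u, hu, ?_⟩
  set x' := ε • ∑ k ∈ Finset.range N, P k with hx'
  set y' := ε • ∑ k ∈ Finset.range N, Q k with hy'
  have h1 : u * x' = y' * u := by
    rw [hx', hy', mul_smul_comm, smul_mul_assoc, Finset.mul_sum, Finset.sum_mul]
    congr 1
    refine Finset.sum_congr rfl fun k hk => ?_
    exact huk (k + 1) (Nat.succ_le_succ (Finset.mem_range.1 hk).le)
  have h2 : u * x - y * u = u * (x - x') - (y - y') * u := by
    rw [mul_sub, sub_mul, h1]; abel
  have hu1 : ‖u‖ = 1 := CStarRing.norm_of_mem_unitary hu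
  have h3 := norm_sub_smul_sum_le hx hε hP' hNx
  have h4 := norm_sub_smul_sum_le hy hε hQ' hNy
  rw [h2]
  calc ‖u * (x - x') - (y - y') * u‖ ≤ ‖u * (x - x')‖ + ‖(y - y') * u‖ := norm_sub_le _ _
    _ ≤ ‖u‖ * ‖x - x'‖ + ‖y - y'‖ * ‖u‖ := add_le_add (norm_mul_le _ _) (norm_mul_le _ _)
    _ ≤ 2 * ε := by rw [hu1]; linarith

/-- Every element is approximately a unitary multiple of its absolute value. -/
theorem exists_unitary_norm_sub_mul_le {τ : A →ₗ[ℂ] ℂ} (hτ : ∀ x y, τ (x * y) = τ (y * x))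
    (hcomp : ∀ p q : A, IsStarProjection p → IsStarProjection q → τ p = τ q →
      ProjectionEquivalent p q)
    (hsupp : ∀ s : A, ∃ e, IsLeftSupport s e) {S x : A} (hx : 0 ≤ x) (hS : star S * S = x * x)
    {ε : ℝ} (hε : 0 < ε) : ∃ u ∈ unitary A, ‖S - u * x‖ ≤ 2 * ε := by
  obtain ⟨e, he⟩ := hsupp (cfc (fun t : ℝ => max (t - ε) 0) x)
  have hes := he.isStarProjection
  obtain ⟨z, hz, hzx, hex, -, hSe⟩ := exists_polar_of_isSpectralProjection hx hS hε he
  set v := S * z with hv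
  have hvpi : v * star v * v = v := mul_star_self_mul_of_isStarProjection (by rw [hz]; exact hes)
  have hf := isStarProjection_mul_star_self hvpi
  -- The trace property gives `e` and `v v*` equal traces, hence also their complements. The added
  -- piece `w` lives on `1 - e`, where `x` is at most `ε`, so it costs little.
  obtain ⟨w, hw, hw'⟩ := hcomp (1 - e) (1 - v * star v) hes.one_sub hf.one_sub (by
    rw [map_sub, map_sub, hτ v, hz])
  have hwpi : w * star w * w = w :=
    mul_star_self_mul_of_isStarProjection (by rw [hw]; exact hes.one_sub)
  have hve : v * e = v := by rw [← hz, ← mul_assoc, hvpi]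
  have hwe : w * (1 - e) = w := by rw [← hw, ← mul_assoc, hwpi]
  have hvw : star v * w = 0 := by
    have h1 : star v * (1 - v * star v) = 0 := by
      have := congrArg star hvpi
      simp only [star_mul, star_star] at this
      rw [mul_sub, mul_one, this, sub_self]
    rw [← hwpi, hw', ← mul_assoc, h1, zero_mul]
  have hvw' : v * star w = 0 := by
    have h1 := congrArg star hwe
    rw [star_mul, hes.one_sub.isSelfAdjoint.star_eq] at h1
    rw [← hve, ← h1, mul_assoc, ← mul_assoc e, hes.mul_one_sub_self, zero_mul, mul_zero]
  have hwv : star w * v = 0 := by simpa using congrArg star hvw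
  have hwv' : w * star v = 0 := by simpa using congrArg star hvw'
  have hu : v + w ∈ unitary A := by
    refine ⟨?_, ?_⟩
    · rw [star_add, add_mul, mul_add, mul_add, hz, hw, hvw, hwv]; abel
    · rw [star_add, add_mul, mul_add, mul_add, hw', hvw', hwv']; abel
  refine ⟨v + w, hu, ?_⟩
  have h1 : S - (v + w) * x = S * (1 - e) - w * (x * (1 - e)) := by
    have h2 : x * (1 - e) = (1 - e) * x := by rw [mul_sub, sub_mul, hex.eq, mul_one, one_mul]
    rw [h2, ← mul_assoc, hwe, add_mul, hzx, mul_sub, mul_one]; abel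
  have hxe : ‖x * (1 - e)‖ ≤ ε := by
    obtain ⟨-, -, -, -, -, h⟩ := exists_polar_of_isSpectralProjection (S := x) hx
      (by rw [(IsSelfAdjoint.of_nonneg hx).star_eq]) hε he
    exact h
  have hwn : ‖w‖ ≤ 1 := by
    have h3 := hes.one_sub.norm_le
    rw [← hw, CStarRing.norm_star_mul_self] at h3
    nlinarith [norm_nonneg w]
  rw [h1]
  calc ‖S * (1 - e) - w * (x * (1 - e))‖ ≤ ‖S * (1 - e)‖ + ‖w * (x * (1 - e))‖ := norm_sub_le _ _
    _ ≤ ‖S * (1 - e)‖ + ‖w‖ * ‖x * (1 - e)‖ := by gcongr; exact norm_mul_le _ _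
    _ ≤ ε + 1 * ε := by gcongr
    _ = 2 * ε := by ring

end Unitary

/-! ### Comparison of projections in a factor -/

namespace VonNeumannAlgebra

attribute [local instance] isClosed_toStarSubalgebra

variable {H : Type*} [NormedAddCommGroup H] [InnerProductSpace ℂ H] [CompleteSpace H]
  {M : VonNeumannAlgebra H} {τ : M.toStarSubalgebra →ₗ[ℂ] ℂ}

theorem IsFaithfulNormalTrace.eq_zero_of_isStarProjection (hτ : M.IsFaithfulNormalTrace τ)
    {p : M.toStarSubalgebra} (hp : IsStarProjection p) (h : τ p = 0) : p = 0 :=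
  hτ.faithful p (by rwa [hp.isSelfAdjoint.star_eq, hp.isIdempotentElem.eq])

/-- Nonzero projections of a factor have nonzero equivalent subprojections. -/
theorem IsFactor.exists_partialIsometry {M : VonNeumannAlgebra H} (hM : M.IsFactor)
    {p q : M.toStarSubalgebra} (hp : IsStarProjection p) (hq : IsStarProjection q)
    (hp0 : p ≠ 0) (hq0 : q ≠ 0) :
    ∃ w : M.toStarSubalgebra, w ≠ 0 ∧ w * star w * w = w ∧ w * p = w ∧ q * w = w := by
  obtain ⟨a, ha⟩ := hM.exists_mul_mul_ne_zero hp0 hq0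
  set y := q * a * p with hy
  have hyp : y * p = y := by rw [hy, mul_assoc, hp.isIdempotentElem.eq]
  have hqy : q * y = y := by rw [hy, ← mul_assoc, ← mul_assoc, hq.isIdempotentElem.eq]
  have hy0 : 0 < ‖y‖ := norm_pos_iff.2 ha
  -- Any level below `‖y‖` would do: if the partial isometry at this level were `0`, then `e = 0`
  -- and `‖y‖ ≤ ‖y‖ / 2`.
  have hε : 0 < ‖y‖ / 2 := half_pos hy0
  have habs := CFC.abs_mul_abs y
  have he := M.isLeftSupport_leftSupport (cfc (fun t : ℝ => max (t - ‖y‖ / 2) 0) (CFC.abs y))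
  set e := M.leftSupport (cfc (fun t : ℝ => max (t - ‖y‖ / 2) 0) (CFC.abs y))
  obtain ⟨z, hz, -, -, ⟨t, ht⟩, hne⟩ :=
    exists_polar_of_isSpectralProjection (CFC.abs_nonneg y) habs.symm hε he
  have hwpi : y * z * star (y * z) * (y * z) = y * z :=
    mul_star_self_mul_of_isStarProjection (by rw [hz]; exact he.isStarProjection)
  -- `e` lies in the left ideal generated by `y`, and `y p = y`.
  have hep : e * p = e := by rw [ht, mul_assoc, hyp]
  refine ⟨y * z, fun h0 => ?_, hwpi, ?_, by rw [← mul_assoc, hqy]⟩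
  · rw [h0, mul_zero] at hz
    rw [← hz, sub_zero, mul_one] at hne
    linarith
  · have hwe : y * z * e = y * z := by rw [← hz, ← mul_assoc, hwpi]
    rw [← hwe, mul_assoc, hep]

/-- A maximal partial isometry between two projections. -/
theorem exists_maximal_partialIsometry (M : VonNeumannAlgebra H) (p q : M.toStarSubalgebra) :
    ∃ m : M.toStarSubalgebra, (m * star m * m = m ∧ m * p = m ∧ q * m = m) ∧
      ∀ w, w * star w * w = w → w * p = w → q * w = w → PartialIsometryExtends m w →
        PartialIsometryExtends w m := by
  let X := {v : M.toStarSubalgebra // v * star v * v = v ∧ v * p = v ∧ q * v = v}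
  let r : X → X → Prop := fun v w => PartialIsometryExtends v.1 w.1
  have htrans : ∀ {u v w : X}, r u v → r v w → r u w := fun {u v w} huv hvw =>
    huv.trans u.2.1 v.2.1 hvw
  obtain ⟨m, hm⟩ := exists_maximal_of_chains_bounded (r := r) (fun c hc => by
    rcases c.eq_empty_or_nonempty with rfl | hne
    · exact ⟨⟨0, by simp, by simp, by simp⟩, by simp⟩
    -- Ordered by extension, a nonempty chain is its own directed index set.
    · let pre : Preorder c :=
        { le := fun v w => r v w
          lt := fun v w => r v w ∧ ¬ r w v
          le_refl := fun v => PartialIsometryExtends.refl v.1.2.1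
          le_trans := fun u v w => htrans }
      have hdir : @IsDirectedOrder c pre.toLE := ⟨fun v w => by
        by_cases hvw : v.1 = w.1
        · have : v = w := Subtype.ext hvw
          exact this ▸ ⟨v, pre.le_refl v, pre.le_refl v⟩
        · rcases hc v.2 w.2 hvw with h | h
          · exact ⟨w, h, pre.le_refl w⟩
          · exact ⟨v, pre.le_refl v, h⟩⟩
      obtain ⟨w, hw, hext, hwp, hwq⟩ := @exists_partialIsometry_upperBound H _ _ _ M c pre hdir
        hne.to_subtype (fun v => v.1.1) (fun v => v.1.2.1) (fun v w h => h)
      exact ⟨⟨w, hw, hwp p fun v => v.1.2.2.1, hwq q fun v => v.1.2.2.2⟩,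
        fun v hv => hext ⟨v, hv⟩⟩) htrans
  exact ⟨m.1, m.2, fun w hw hwp hwq h => hm ⟨w, hw, hwp, hwq⟩ h⟩

/-- In a factor with a faithful trace, projections with equal traces are equivalent. -/
theorem IsFactor.projectionEquivalent (hM : M.IsFactor) (hτ : M.IsFaithfulNormalTrace τ)
    {p q : M.toStarSubalgebra} (hp : IsStarProjection p) (hq : IsStarProjection q)
    (hpq : τ p = τ q) : ProjectionEquivalent p q := by
  obtain ⟨m, ⟨hm, hmp, hqm⟩, hmax⟩ := M.exists_maximal_partialIsometry p q
  have hpm : p * star m = star m := by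
    have := congrArg star hmp
    rwa [star_mul, hp.isSelfAdjoint.star_eq] at this
  have hmq : star m * q = star m := by
    have := congrArg star hqm
    rwa [star_mul, hq.isSelfAdjoint.star_eq] at this
  have hm' : star m * (m * star m) = star m := by
    have := congrArg star hm
    simpa only [star_mul, star_star] using this
  have hp' : IsStarProjection (p - star m * m) :=
    (isStarProjection_star_mul_self hm).sub_of_mul_eq_left hp (by rw [mul_assoc, hmp])
  have hq' : IsStarProjection (q - m * star m) :=
    (isStarProjection_mul_star_self hm).sub_of_mul_eq_left hq (by rw [mul_assoc, hmq])
  have hτ' : τ (p - star m * m) = τ (q - m * star m) := by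
    rw [map_sub, map_sub, hpq, hτ.map_mul_comm m]
  -- Two nonzero remainders would be linked by some `w ≠ 0` orthogonal to `m` on both sides, and `m
  -- + w` would properly extend `m`.
  have key : p - star m * m = 0 ∨ q - m * star m = 0 := by
    by_contra! h
    obtain ⟨w, hw0, hw, hwp, hqw⟩ := hM.exists_partialIsometry hp' hq' h.1 h.2
    have hpw : (p - star m * m) * star w = star w := by
      have := congrArg star hwp
      rwa [star_mul, hp'.isSelfAdjoint.star_eq] at this
    have h1 : w * star m = 0 := by
      rw [← hwp, mul_assoc, sub_mul, hpm, mul_assoc, hm', sub_self, mul_zero]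
    have h2 : star m * w = 0 := by
      rw [← hqw, ← mul_assoc, mul_sub, hmq, hm', sub_self, zero_mul]
    have h3 : m * star w = 0 := by simpa using congrArg star h1
    have h4 : star w * m = 0 := by simpa using congrArg star h2
    have hsq : star (m + w) * (m + w) = star m * m + star w * w := by
      rw [star_add, add_mul, mul_add, mul_add, h2, h4]; abel
    have h5 : (m + w) * star (m + w) * (m + w) = m + w := by
      rw [mul_assoc, hsq, add_mul, mul_add, mul_add, ← mul_assoc, ← mul_assoc, ← mul_assoc,
        ← mul_assoc, hm, hw, h1, h3]
      simp
    have h6 : (m + w) * p = m + w := by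
      have : w * p = w := by
        rw [← hwp, mul_assoc, sub_mul, hp.isIdempotentElem.eq, mul_assoc, hmp]
      rw [add_mul, hmp, this]
    have h7 : q * (m + w) = m + w := by
      have : q * w = w := by
        rw [← hqw, ← mul_assoc, mul_sub, hq.isIdempotentElem.eq, ← mul_assoc, hqm]
      rw [mul_add, hqm, this]
    have h8 : PartialIsometryExtends m (m + w) := by
      rw [PartialIsometryExtends, add_mul, ← mul_assoc, hm, ← mul_assoc, h1, zero_mul, add_zero]
    have h9 : m * (star (m + w) * (m + w)) = m + w := hmax _ h5 h6 h7 h8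
    rw [hsq, mul_add, ← mul_assoc, hm, ← mul_assoc, h3, zero_mul, add_zero] at h9
    exact hw0 (left_eq_add.1 h9)
  have hp0 : p - star m * m = 0 := by
    rcases key with h | h
    · exact h
    · exact hτ.eq_zero_of_isStarProjection hp' (by rw [hτ', h, map_zero])
  have hq0 : q - m * star m = 0 :=
    hτ.eq_zero_of_isStarProjection hq' (by rw [← hτ', hp0, map_zero])
  exact ⟨m, (sub_eq_zero.1 hp0).symm, (sub_eq_zero.1 hq0).symm⟩

end VonNeumannAlgebra

/-! ### The trace on continuous functions and on spectral projections -/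

namespace VonNeumannAlgebra

attribute [local instance] isClosed_toStarSubalgebra

open Filter Topology MeasureTheory

variable {H : Type*} [NormedAddCommGroup H] [InnerProductSpace ℂ H] [CompleteSpace H]
  {M : VonNeumannAlgebra H} {τ : M.toStarSubalgebra →ₗ[ℂ] ℂ}

open scoped ComplexOrder in
theorem IsFaithfulNormalTrace.map_nonneg (hτ : M.IsFaithfulNormalTrace τ)
    {x : M.toStarSubalgebra} (hx : 0 ≤ x) : 0 ≤ τ x := by
  obtain ⟨y, rfl⟩ := CStarAlgebra.nonneg_iff_eq_star_mul_self.1 hx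
  exact hτ.nonneg y

open scoped ComplexOrder in
theorem IsFaithfulNormalTrace.exists_norm_le (hτ : M.IsFaithfulNormalTrace τ) :
    ∃ C : ℝ, 0 ≤ C ∧ ∀ x, ‖τ x‖ ≤ C * ‖x‖ := by
  let φ : M.toStarSubalgebra →ₚ[ℂ] ℂ := PositiveLinearMap.mk₀ τ fun x hx => hτ.map_nonneg hx
  obtain ⟨C, hC⟩ := PositiveLinearMap.exists_norm_apply_le φ
  exact ⟨C, C.2, hC⟩

theorem IsFaithfulNormalTrace.continuous (hτ : M.IsFaithfulNormalTrace τ) : Continuous τ := by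
  obtain ⟨C, -, hC⟩ := hτ.exists_norm_le
  exact AddMonoidHomClass.continuous_of_bound τ C hC

theorem norm_cfc_sub_aeval_le {A : Type*} [CStarAlgebra A] {x : A} (hx : IsSelfAdjoint x)
    {f : ℝ → ℝ} (hf : Continuous f) {p : Polynomial ℝ} {R ε : ℝ} (hR : ‖x‖ ≤ R)
    (hp : ∀ t ∈ Set.Icc (-R) R, |p.eval t - f t| < ε) (hε : 0 ≤ ε) :
    ‖cfc f x - Polynomial.aeval x p‖ ≤ ε := by
  rcases subsingleton_or_nontrivial A with hA | hA
  · rwa [Subsingleton.elim (cfc f x - Polynomial.aeval x p) 0, norm_zero]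
  rw [← cfc_polynomial p x, ← cfc_sub f p.eval x (by fun_prop) (by fun_prop)]
  refine norm_cfc_le hε fun t ht => ?_
  have h1 : |t| ≤ R := (spectrum.norm_le_norm_of_mem ht).trans hR
  have h2 := hp t (abs_le.1 h1)
  rw [abs_sub_comm] at h2
  exact h2.le

/-- Elements with equal moments have equal traces under the continuous functional calculus. -/
theorem IsFaithfulNormalTrace.map_cfc_eq (hτ : M.IsFaithfulNormalTrace τ)
    {x y : M.toStarSubalgebra} (hx : IsSelfAdjoint x) (hy : IsSelfAdjoint y)
    (hxy : ∀ n : ℕ, τ (x ^ n) = τ (y ^ n)) {f : ℝ → ℝ} (hf : Continuous f) :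
    τ (cfc f x) = τ (cfc f y) := by
  obtain ⟨C, hC0, hC⟩ := hτ.exists_norm_le
  have hpoly : ∀ p : Polynomial ℝ, τ (Polynomial.aeval x p) = τ (Polynomial.aeval y p) := by
    intro p
    rw [Polynomial.aeval_eq_sum_range, Polynomial.aeval_eq_sum_range, map_sum, map_sum]
    refine Finset.sum_congr rfl fun i _ => ?_
    rw [← Complex.coe_smul, ← Complex.coe_smul, map_smul, map_smul, hxy]
  refine eq_of_forall_dist_le fun ε hε => ?_
  -- The `+ 1` guards against `C = 0`; the two approximation errors add up to `2 C δ ≤ ε`.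
  set δ := ε / (2 * (C + 1)) with hδ
  have hδ0 : 0 < δ := by positivity
  obtain ⟨p, hp⟩ := exists_polynomial_near_of_continuousOn (-max ‖x‖ ‖y‖) (max ‖x‖ ‖y‖) f
    hf.continuousOn δ hδ0
  have h1 := norm_cfc_sub_aeval_le hx hf (le_max_left _ _) hp hδ0.le
  have h2 := norm_cfc_sub_aeval_le hy hf (le_max_right _ _) hp hδ0.le
  have h3 : τ (cfc f x) - τ (cfc f y) = τ (cfc f x - Polynomial.aeval x p) -
      τ (cfc f y - Polynomial.aeval y p) := by
    rw [map_sub, map_sub, hpoly]; ring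
  have h4 : ‖τ (cfc f x - Polynomial.aeval x p)‖ ≤ C * δ :=
    (hC _).trans (mul_le_mul_of_nonneg_left h1 hC0)
  have h5 : ‖τ (cfc f y - Polynomial.aeval y p)‖ ≤ C * δ :=
    (hC _).trans (mul_le_mul_of_nonneg_left h2 hC0)
  have h6 : 2 * (C + 1) * δ = ε := by rw [hδ]; field_simp
  rw [dist_eq_norm, h3]
  refine (norm_sub_le _ _).trans ?_
  nlinarith

/-- The functions `t⁺ / (t⁺ + 1 / (n + 1))` with `t⁺` the positive part of `t - a`: these increase
to the indicator function of `(a, ∞)`. -/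
noncomputable def approxIndicator (a : ℝ) (n : ℕ) (t : ℝ) : ℝ :=
  max (t - a) 0 * (max (t - a) 0 + 1 / ((n : ℝ) + 1))⁻¹

theorem approxIndicator_denom_pos (a : ℝ) (n : ℕ) (t : ℝ) :
    0 < max (t - a) 0 + 1 / ((n : ℝ) + 1) :=
  add_pos_of_nonneg_of_pos (le_max_right _ _) Nat.one_div_pos_of_nat

theorem continuous_approxIndicator_denom_inv (a : ℝ) (n : ℕ) :
    Continuous fun t : ℝ => (max (t - a) 0 + 1 / ((n : ℝ) + 1))⁻¹ :=
  Continuous.inv₀ (by fun_prop) fun t => (approxIndicator_denom_pos a n t).ne'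

theorem continuous_approxIndicator (a : ℝ) (n : ℕ) : Continuous (approxIndicator a n) :=
  Continuous.mul (by fun_prop) (continuous_approxIndicator_denom_inv a n)

theorem approxIndicator_nonneg (a : ℝ) (n : ℕ) (t : ℝ) : 0 ≤ approxIndicator a n t :=
  mul_nonneg (le_max_right _ _) (inv_nonneg.2 (approxIndicator_denom_pos a n t).le)

theorem approxIndicator_le_one (a : ℝ) (n : ℕ) (t : ℝ) : approxIndicator a n t ≤ 1 := by
  rw [approxIndicator, ← div_eq_mul_inv, div_le_one (approxIndicator_denom_pos a n t)]
  exact le_add_of_nonneg_right Nat.one_div_pos_of_nat.le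

theorem approxIndicator_mono (a : ℝ) {m n : ℕ} (h : m ≤ n) (t : ℝ) :
    approxIndicator a m t ≤ approxIndicator a n t := by
  have h1 : 1 / ((n : ℝ) + 1) ≤ 1 / ((m : ℝ) + 1) := Nat.one_div_le_one_div h
  exact mul_le_mul_of_nonneg_left (inv_anti₀ (approxIndicator_denom_pos a n t) (by linarith))
    (le_max_right _ _)

/-- The error is exactly `approxIndicator a n t / (n + 1)`. Being uniform in `t`, the bound makes
these functions of `x` a norm approximate unit for `(x - a)⁺`. -/
theorem abs_approxIndicator_mul_sub_le (a : ℝ) (n : ℕ) (t : ℝ) :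
    |approxIndicator a n t * max (t - a) 0 - max (t - a) 0| ≤ 1 / ((n : ℝ) + 1) := by
  have hd := approxIndicator_denom_pos a n t
  have h0 : (0 : ℝ) < 1 / ((n : ℝ) + 1) := Nat.one_div_pos_of_nat
  have h1 : approxIndicator a n t * max (t - a) 0 - max (t - a) 0 =
      -(1 / ((n : ℝ) + 1) * approxIndicator a n t) := by
    rw [approxIndicator]
    set s := max (t - a) 0
    set d := 1 / ((n : ℝ) + 1)
    field_simp
    ring
  rw [h1, abs_neg, abs_of_nonneg (mul_nonneg h0.le (approxIndicator_nonneg a n t))]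
  exact mul_le_of_le_one_right h0.le (approxIndicator_le_one a n t)

/-- The trace of a spectral projection is the supremum of the traces of continuous functions. -/
theorem IsFaithfulNormalTrace.isLUB_re_map_cfc (hτ : M.IsFaithfulNormalTrace τ)
    (x : M.toStarSubalgebra) (a : ℝ) :
    IsLUB (Set.range fun n => (τ (cfc (approxIndicator a n) x)).re)
      (τ (M.leftSupport (cfc (fun t : ℝ => max (t - a) 0) x))).re := by
  set s := cfc (fun t : ℝ => max (t - a) 0) x with hs
  set F : ℕ → M.toStarSubalgebra := fun n => cfc (approxIndicator a n) x with hF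
  have hsupp := M.isLeftSupport_leftSupport s
  set e := M.leftSupport s with he
  have hes := hsupp.isStarProjection
  have hF0 : ∀ n, 0 ≤ F n := fun n => cfc_nonneg fun t _ => approxIndicator_nonneg a n t
  have hmono : Monotone F := fun m n h => cfc_mono (fun t _ => approxIndicator_mono a h t)
    (continuous_approxIndicator a m).continuousOn (continuous_approxIndicator a n).continuousOn
  have heF : ∀ n, e * F n = F n := fun n => by
    have h1 : F n = s * cfc (fun t : ℝ => (max (t - a) 0 + 1 / ((n : ℝ) + 1))⁻¹) x :=
      cfc_mul (fun t : ℝ => max (t - a) 0) _ x (by fun_prop)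
        (continuous_approxIndicator_denom_inv a n).continuousOn
    rw [h1, ← mul_assoc, hsupp.mul_eq]
  have hFe : ∀ n, F n * e = F n := fun n => by
    have := congrArg star (heF n)
    rwa [star_mul, hes.isSelfAdjoint.star_eq, (IsSelfAdjoint.of_nonneg (hF0 n)).star_eq] at this
  -- Compress `F n ≤ 1` by `e`.
  have hF1 : ∀ n, F n ≤ e := fun n => by
    have h1 : F n ≤ 1 := cfc_le_one _ _ fun t _ => approxIndicator_le_one a n t
    have h2 := star_right_conjugate_le_conjugate h1 e
    rwa [hes.isSelfAdjoint.star_eq, heF, hFe, mul_one, hes.isIdempotentElem.eq] at h2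
  have hlim : Tendsto (fun n => F n * s) atTop (𝓝 s) := by
    rw [tendsto_iff_norm_sub_tendsto_zero]
    refine squeeze_zero (fun n => norm_nonneg _) (fun n => ?_)
      (tendsto_one_div_add_atTop_nhds_zero_nat (𝕜 := ℝ))
    have hc : Continuous fun t : ℝ => approxIndicator a n t * max (t - a) 0 :=
      (continuous_approxIndicator a n).mul (by fun_prop)
    rw [hF, hs, ← cfc_mul (approxIndicator a n) (fun t : ℝ => max (t - a) 0) x
      (continuous_approxIndicator a n).continuousOn (by fun_prop),
      ← cfc_sub (fun t : ℝ => approxIndicator a n t * max (t - a) 0) (fun t : ℝ => max (t - a) 0) x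
      hc.continuousOn (by fun_prop)]
    exact norm_cfc_le Nat.one_div_pos_of_nat.le fun t _ => abs_approxIndicator_mul_sub_le a n t
  have := hτ.normal (Set.range F) e (Set.range_nonempty F)
    (directedOn_range.2 hmono.directed_le) (by rintro _ ⟨n, rfl⟩; exact hF0 n)
    (M.isLUB_range_leftSupport hF0 hF1 hlim)
  rwa [← Set.range_comp] at this

open scoped ComplexOrder in
theorem IsFaithfulNormalTrace.im_map_eq_zero (hτ : M.IsFaithfulNormalTrace τ)
    {p : M.toStarSubalgebra} (hp : IsStarProjection p) : (τ p).im = 0 :=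
  (Complex.le_def.1 (hτ.map_nonneg hp.nonneg)).2.symm

/-- Elements with equal moments have spectral projections with equal traces. -/
theorem IsFaithfulNormalTrace.map_spectralProjection_eq (hτ : M.IsFaithfulNormalTrace τ)
    {x y : M.toStarSubalgebra} (hx : IsSelfAdjoint x) (hy : IsSelfAdjoint y)
    (hxy : ∀ n : ℕ, τ (x ^ n) = τ (y ^ n)) {a : ℝ} {p q : M.toStarSubalgebra}
    (hp : IsSpectralProjection x a p) (hq : IsSpectralProjection y a q) : τ p = τ q := by
  have h1 := hτ.isLUB_re_map_cfc x a
  have h2 := hτ.isLUB_re_map_cfc y a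
  rw [IsLeftSupport.unique (M.isLeftSupport_leftSupport _) hp] at h1
  rw [IsLeftSupport.unique (M.isLeftSupport_leftSupport _) hq] at h2
  simp only [hτ.map_cfc_eq hx hy hxy (continuous_approxIndicator a _)] at h1
  refine Complex.ext (h1.unique h2) ?_
  rw [hτ.im_map_eq_zero (IsLeftSupport.isStarProjection hp),
    hτ.im_map_eq_zero (IsLeftSupport.isStarProjection hq)]

/-! ### Absolute values under two-sided unitary multiplication -/

theorem absVal_nonneg (M : VonNeumannAlgebra H) (x : M.toStarSubalgebra) : 0 ≤ M.absVal x :=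
  CFC.abs_nonneg (x : H →L[ℂ] H)

theorem absVal_mul_absVal (M : VonNeumannAlgebra H) (x : M.toStarSubalgebra) :
    M.absVal x * M.absVal x = star x * x :=
  Subtype.ext (CFC.abs_mul_abs (x : H →L[ℂ] H))

theorem continuous_absVal (M : VonNeumannAlgebra H) : Continuous M.absVal :=
  Continuous.subtype_mk (CFC.continuous_abs.comp continuous_subtype_val) _

/-- By uniqueness of positive square roots: `V* |x| V` is positive and its square is `V* x* x V`,
from which `U` has cancelled. -/
theorem absVal_unitary_mul_mul (M : VonNeumannAlgebra H) {U V : M.toStarSubalgebra}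
    (hU : U ∈ unitary M.toStarSubalgebra) (hV : V ∈ unitary M.toStarSubalgebra)
    (x : M.toStarSubalgebra) : M.absVal (U * x * V) = star V * M.absVal x * V := by
  have h1 : 0 ≤ star V * M.absVal x * V := star_left_conjugate_nonneg (M.absVal_nonneg x) V
  have h2 : star V * M.absVal x * V * (star V * M.absVal x * V) =
      star (U * x * V) * (U * x * V) := by
    calc _ = star V * M.absVal x * (V * star V) * M.absVal x * V := by simp only [mul_assoc]
      _ = star V * (M.absVal x * M.absVal x) * V := by
        rw [Unitary.mul_star_self_of_mem hV, mul_one]; simp only [mul_assoc]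
      _ = star V * (star x * (star U * U) * x) * V := by
        rw [absVal_mul_absVal, Unitary.star_mul_self_of_mem hU, mul_one]
      _ = _ := by simp only [star_mul, mul_assoc]
  rw [← CFC.sqrt_unique h2 h1, ← CFC.sqrt_unique (M.absVal_mul_absVal _) (M.absVal_nonneg _)]

theorem IsFaithfulNormalTrace.map_conj_pow (hτ : M.IsFaithfulNormalTrace τ)
    {V : M.toStarSubalgebra} (hV : V ∈ unitary M.toStarSubalgebra) (x : M.toStarSubalgebra)
    (n : ℕ) : τ ((star V * x * V) ^ n) = τ (x ^ n) := by
  have h1 : (star V * x * V) ^ n = star V * x ^ n * V := by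
    induction n with
    | zero => rw [pow_zero, pow_zero, mul_one, Unitary.star_mul_self_of_mem hV]
    | succ n ih =>
      rw [pow_succ, ih, pow_succ]
      calc _ = star V * x ^ n * (V * star V) * x * V := by simp only [mul_assoc]
        _ = _ := by rw [Unitary.mul_star_self_of_mem hV, mul_one]; simp only [mul_assoc]
  rw [h1, hτ.map_mul_comm, ← mul_assoc, Unitary.mul_star_self_of_mem hV, one_mul]

/-! ### Singular value functions and moments -/

theorem IsFaithfulNormalTrace.isSpectralDistribution (hτ : M.IsFaithfulNormalTrace τ)
    {x : M.toStarSubalgebra} (hx : IsSelfAdjoint x) :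
    M.IsSpectralDistribution τ x (M.spectralDistribution τ x) := by
  have h := (M.existsUnique_isSpectralDistribution hτ hx).exists
  rw [spectralDistribution, dif_pos h]
  exact h.choose_spec

/-- The distribution function of a measure carried by a half-line `(-∞, R]` is recovered from the
generalized inverse of its tail function. -/
theorem sInf_tail_le_iff {m : Measure ℝ} [IsProbabilityMeasure m] {R : ℝ}
    (hR : m (Set.Ioi R) = 0) {s : ℝ} (hs : s ∈ Set.Ico (0 : ℝ) 1) (t : ℝ) :
    sInf {r : ℝ | m (Set.Ioi r) ≤ ENNReal.ofReal s} ≤ t ↔ m (Set.Ioi t) ≤ ENNReal.ofReal s := by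
  set X := {r : ℝ | m (Set.Ioi r) ≤ ENNReal.ofReal s} with hX
  have hs1 : ENNReal.ofReal s < 1 := by
    rw [← ENNReal.ofReal_one]; exact (ENNReal.ofReal_lt_ofReal_iff one_pos).2 hs.2
  have hup : ∀ r ∈ X, ∀ r', r ≤ r' → r' ∈ X := fun r hr r' h =>
    (measure_mono (Set.Ioi_subset_Ioi h)).trans hr
  have hne : X.Nonempty := ⟨R, by rw [hX, Set.mem_ofPred_eq, hR]; exact zero_le⟩
  -- Here `s < 1` is essential: tails tend to `1` at `-∞`, so they eventually exceed `s`.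
  have hbdd : BddBelow X := by
    have h1 : Filter.Tendsto (fun r : ℝ => m (Set.Ioi r)) Filter.atBot (nhds (m Set.univ)) := by
      have h2 : (⋃ r : ℝ, Set.Ioi r) = Set.univ :=
        Set.eq_univ_of_forall fun t => Set.mem_iUnion.2 ⟨t - 1, sub_one_lt t⟩
      rw [← h2]
      exact tendsto_measure_iUnion_atBot fun a b h => Set.Ioi_subset_Ioi h
    rw [measure_univ] at h1
    obtain ⟨r, hr⟩ := (h1.eventually (lt_mem_nhds hs1)).exists
    exact ⟨r, fun r' hr' => le_of_lt (not_le.1 fun h => hr.not_ge (hup r' hr' r h))⟩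
  refine ⟨fun h => ?_, fun h => csInf_le hbdd h⟩
  -- The tail is right continuous, so the infimum is attained.
  have h1 : ∀ n : ℕ, m (Set.Ioi (t + 1 / ((n : ℝ) + 1))) ≤ ENNReal.ofReal s := fun n => by
    have h0 : (0 : ℝ) < 1 / ((n : ℝ) + 1) := Nat.one_div_pos_of_nat
    obtain ⟨r, hr, hrt⟩ := exists_lt_of_csInf_lt hne
      (show sInf X < t + 1 / ((n : ℝ) + 1) by linarith)
    exact hup r hr _ hrt.le
  have h2 : (⋃ n : ℕ, Set.Ioi (t + 1 / ((n : ℝ) + 1))) = Set.Ioi t := by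
    refine Set.Subset.antisymm (Set.iUnion_subset fun n => Set.Ioi_subset_Ioi ?_) fun u hu => ?_
    · exact le_add_of_nonneg_right Nat.one_div_pos_of_nat.le
    · obtain ⟨n, hn⟩ := exists_nat_one_div_lt (sub_pos.2 (Set.mem_Ioi.1 hu))
      exact Set.mem_iUnion.2 ⟨n, by rw [Set.mem_Ioi]; linarith⟩
  have h3 : Monotone fun n : ℕ => Set.Ioi (t + 1 / ((n : ℝ) + 1)) := fun a b h =>
    Set.Ioi_subset_Ioi (by linarith [Nat.one_div_le_one_div (α := ℝ) h])
  have h4 := tendsto_measure_iUnion_atTop (μ := m) h3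
  rw [h2] at h4
  exact le_of_tendsto' h4 h1

/-- Take `s = m (t, ∞)` in the equivalence `sInf_tail_le_iff`. The value `1` lies outside the range
of `s`, but then the bound is trivial. -/
theorem measure_Ioi_le_of_sInf_tail_eq {m m' : Measure ℝ} [IsProbabilityMeasure m]
    [IsProbabilityMeasure m'] {R R' : ℝ} (hR : m (Set.Ioi R) = 0) (hR' : m' (Set.Ioi R') = 0)
    (h : ∀ s ∈ Set.Ico (0 : ℝ) 1, sInf {r : ℝ | m (Set.Ioi r) ≤ ENNReal.ofReal s} =
      sInf {r : ℝ | m' (Set.Ioi r) ≤ ENNReal.ofReal s}) (t : ℝ) :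
    m' (Set.Ioi t) ≤ m (Set.Ioi t) := by
  rcases (prob_le_one (μ := m) (s := Set.Ioi t)).eq_or_lt with h1 | h1
  · rw [h1]; exact prob_le_one
  · have hfin := measure_ne_top m (Set.Ioi t)
    have hs : (m (Set.Ioi t)).toReal ∈ Set.Ico (0 : ℝ) 1 :=
      ⟨ENNReal.toReal_nonneg, by
        rw [← ENNReal.toReal_one]; exact (ENNReal.toReal_lt_toReal hfin ENNReal.one_ne_top).2 h1⟩
    have h2 := (sInf_tail_le_iff hR hs t).2 (ENNReal.ofReal_toReal hfin).ge
    rw [h _ hs, sInf_tail_le_iff hR' hs, ENNReal.ofReal_toReal hfin] at h2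
    exact h2

theorem measure_eq_of_sInf_tail_eq {m m' : Measure ℝ} [IsProbabilityMeasure m]
    [IsProbabilityMeasure m'] {R R' : ℝ} (hR : m (Set.Ioi R) = 0) (hR' : m' (Set.Ioi R') = 0)
    (h : ∀ s ∈ Set.Ico (0 : ℝ) 1, sInf {r : ℝ | m (Set.Ioi r) ≤ ENNReal.ofReal s} =
      sInf {r : ℝ | m' (Set.Ioi r) ≤ ENNReal.ofReal s}) : m = m' := by
  refine Measure.ext_of_Iic m m' fun t => ?_
  have h1 : m (Set.Ioi t) = m' (Set.Ioi t) :=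
    le_antisymm (measure_Ioi_le_of_sInf_tail_eq hR' hR (fun s hs => (h s hs).symm) t)
      (measure_Ioi_le_of_sInf_tail_eq hR hR' h t)
  rw [← Set.compl_Ioi, measure_compl measurableSet_Ioi (measure_ne_top _ _),
    measure_compl measurableSet_Ioi (measure_ne_top _ _), h1, measure_univ, measure_univ]

theorem IsFaithfulNormalTrace.exists_spectralDistribution_Ioi_eq_zero
    (hτ : M.IsFaithfulNormalTrace τ) {x : M.toStarSubalgebra} (hx : IsSelfAdjoint x) :
    ∃ R, M.spectralDistribution τ x (Set.Ioi R) = 0 := by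
  obtain ⟨m, R, hm, -, hR⟩ := M.exists_isSpectralDistribution_aux hτ hx
  have h1 := (M.existsUnique_isSpectralDistribution hτ hx).unique hm (hτ.isSpectralDistribution hx)
  refine ⟨R, ?_⟩
  rw [← h1]
  refine measure_mono_null (fun t ht => ?_) (ae_iff.1 hR)
  exact not_le.2 (lt_of_lt_of_le ht (le_abs_self t))

/-- Two elements have the same singular values if and only if their absolute values have the same
moments. -/
theorem IsFaithfulNormalTrace.singularValueFunction_eq_iff (hτ : M.IsFaithfulNormalTrace τ)
    (S T : M.toStarSubalgebra) :
    (∀ s ∈ Set.Ico (0 : ℝ) 1, M.singularValueFunction τ S s = M.singularValueFunction τ T s) ↔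
      ∀ n : ℕ, τ (M.absVal S ^ n) = τ (M.absVal T ^ n) := by
  have hS : IsSelfAdjoint (M.absVal S) := .of_nonneg (M.absVal_nonneg S)
  have hT : IsSelfAdjoint (M.absVal T) := .of_nonneg (M.absVal_nonneg T)
  have hdS := hτ.isSpectralDistribution hS
  have hdT := hτ.isSpectralDistribution hT
  refine ⟨fun h n => ?_, fun h s _ => ?_⟩
  · have := hdS.isProbabilityMeasure
    have := hdT.isProbabilityMeasure
    obtain ⟨R, hR⟩ := hτ.exists_spectralDistribution_Ioi_eq_zero hS
    obtain ⟨R', hR'⟩ := hτ.exists_spectralDistribution_Ioi_eq_zero hT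
    rw [← hdS.integral_pow, ← hdT.integral_pow, measure_eq_of_sInf_tail_eq hR hR' h]
  · have h1 : M.IsSpectralDistribution τ (M.absVal T) (M.spectralDistribution τ (M.absVal S)) :=
      ⟨hdS.isProbabilityMeasure, hdS.integrable_pow, fun n => (hdS.integral_pow n).trans (h n)⟩
    have h2 := (M.existsUnique_isSpectralDistribution hτ hT).unique h1 hdT
    rw [singularValueFunction, singularValueFunction, eigenvalueFunction, eigenvalueFunction, h2]

/-! ### The two inclusions -/

theorem IsFaithfulNormalTrace.closedTwoSidedUnitaryOrbit_subset (hτ : M.IsFaithfulNormalTrace τ)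
    (T : M.toStarSubalgebra) : M.closedTwoSidedUnitaryOrbit T ⊆
      {S | ∀ n : ℕ, τ (M.absVal S ^ n) = τ (M.absVal T ^ n)} := by
  refine closure_minimal ?_ ?_
  · rintro _ ⟨U, hU, V, hV, rfl⟩ n
    rw [absVal_unitary_mul_mul M hU hV, hτ.map_conj_pow hV]
  · rw [Set.ofPred_forall]
    exact isClosed_iInter fun n =>
      isClosed_eq (hτ.continuous.comp (M.continuous_absVal.pow n)) continuous_const

theorem IsFactor.mem_closedTwoSidedUnitaryOrbit (hM : M.IsFactor) (hτ : M.IsFaithfulNormalTrace τ)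
    {S T : M.toStarSubalgebra} (h : ∀ n : ℕ, τ (M.absVal S ^ n) = τ (M.absVal T ^ n)) :
    S ∈ M.closedTwoSidedUnitaryOrbit T := by
  have hcomp : ∀ p q : M.toStarSubalgebra, IsStarProjection p → IsStarProjection q → τ p = τ q →
      ProjectionEquivalent p q := fun p q hp hq => hM.projectionEquivalent hτ hp hq
  have hsupp : ∀ s : M.toStarSubalgebra, ∃ e, IsLeftSupport s e := fun s =>
    ⟨_, M.isLeftSupport_leftSupport s⟩
  have hS := M.absVal_nonneg S
  have hT := M.absVal_nonneg T
  have : Nontrivial M.toStarSubalgebra := hM.nontrivial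
  refine Metric.mem_closure_iff.2 fun ε hε => ?_
  -- Three errors of size `2 (ε / 8)` total `3 ε / 4 < ε`.
  have hδ : 0 < ε / 8 := by positivity
  obtain ⟨u, hu, hus⟩ := exists_unitary_norm_sub_mul_le hτ.map_mul_comm hcomp hsupp hS
    (M.absVal_mul_absVal S).symm hδ
  obtain ⟨v, hv, hvt⟩ := exists_unitary_norm_sub_mul_le hτ.map_mul_comm hcomp hsupp hT
    (M.absVal_mul_absVal T).symm hδ
  obtain ⟨w, hw, hwst⟩ := exists_unitary_norm_mul_sub_mul_le hcomp hsupp hT hS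
    (fun a p q hp hq => hτ.map_spectralProjection_eq (.of_nonneg hT) (.of_nonneg hS)
      (fun n => (h n).symm) hp hq) hδ
  have hv' := Unitary.star_mem hv
  have hw' := Unitary.star_mem hw
  refine ⟨u * (w * star v) * T * star w, ⟨_, mul_mem hu (mul_mem hw hv'), _, hw', rfl⟩, ?_⟩
  have hn : ∀ {z : M.toStarSubalgebra}, z ∈ unitary M.toStarSubalgebra → ‖z‖ = 1 :=
    fun hz => CStarRing.norm_of_mem_unitary hz
  -- Telescopes `S ≈ u |S| ≈ u w |T| w* ≈ u w v* T w*`; unitary factors do not increase the three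
  -- errors.
  have key : S - u * (w * star v) * T * star w = (S - u * M.absVal S)
      - u * (w * M.absVal T - M.absVal S * w) * star w
      - u * (w * star v) * (T - v * M.absVal T) * star w := by
    have h1 : u * (M.absVal S * w) * star w = u * M.absVal S := by
      rw [mul_assoc, mul_assoc, Unitary.mul_star_self_of_mem hw, mul_one]
    have h2 : u * (w * star v) * (v * M.absVal T) = u * (w * M.absVal T) := by
      calc _ = u * (w * (star v * v) * M.absVal T) := by simp only [mul_assoc]
        _ = _ := by rw [Unitary.star_mul_self_of_mem hv, mul_one]
    rw [mul_sub, sub_mul, h1, mul_sub, sub_mul, h2]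
    abel
  have hb : ∀ {a b z : M.toStarSubalgebra}, a ∈ unitary M.toStarSubalgebra →
      b ∈ unitary M.toStarSubalgebra → ‖a * z * b‖ ≤ ‖z‖ := fun {a b z} ha hb => by
    calc ‖a * z * b‖ ≤ ‖a‖ * ‖z‖ * ‖b‖ := norm_mul₃_le
      _ = ‖z‖ := by rw [hn ha, hn hb, one_mul, mul_one]
  rw [dist_eq_norm, key]
  have h3 := hb hu hw' (z := w * M.absVal T - M.absVal S * w)
  have h4 := hb (mul_mem hu (mul_mem hw hv')) hw' (z := T - v * M.absVal T)
  calc _ ≤ ‖S - u * M.absVal S‖ + ‖u * (w * M.absVal T - M.absVal S * w) * star w‖ +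
        ‖u * (w * star v) * (T - v * M.absVal T) * star w‖ :=
        (norm_sub_le _ _).trans (add_le_add (norm_sub_le _ _) le_rfl)
    _ < ε := by linarith

end VonNeumannAlgebra

theorem mainTheorem3 {H : Type*} [NormedAddCommGroup H] [InnerProductSpace ℂ H] [CompleteSpace H]
    (M : VonNeumannAlgebra H) (hM : M.IsIIOneFactor)
    (τ : M.toStarSubalgebra →ₗ[ℂ] ℂ) (hτ : M.IsFaithfulNormalTrace τ)
    (T : M.toStarSubalgebra) :
    M.closedTwoSidedUnitaryOrbit T =
      {S : M.toStarSubalgebra | ∀ s ∈ Set.Ico (0 : ℝ) 1,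
        M.singularValueFunction τ S s = M.singularValueFunction τ T s} := by
  ext S
  rw [Set.mem_ofPred_eq, hτ.singularValueFunction_eq_iff]
  exact ⟨fun h => hτ.closedTwoSidedUnitaryOrbit_subset T h,
    fun h => hM.isFactor.mem_closedTwoSidedUnitaryOrbit hτ h⟩
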